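/- Let $A$ be a finite set of $m \ge 4$ alternatives. An electorate is a finite non-empty set $N \subseteq \{1,2,3,\dots\}$ of voters; a profile $R=(\succ_i)_{i\in N}$ on $N$ assigns to every voter $i \in N$ a strict linear order $\succ_i$ on $A$; a lottery is a probability distribution on $A$; and a social decision scheme (SDS) $f$ maps every profile on every electorate to a lottery. For lotteries $p,q$ and a preference relation $\succ_i$ write $$p \succsim_i^{PC} q \iff \sum_{x,y\in A:\, x\succ_i y} p(x)q(y) \;\ge\; \sum_{x,y\in A:\, x\succ_i y} q(x)p(y),$$ and $p \succ_i^{PC} q$ if $p\succsim_i^{PC} q$ and not $q\succsim_i^{PC}p$. For an electorate $N$, the SDS $f$ is called - anonymous on $N$ if $f(R)$ does not change when the preference relations of $R$ are permuted among the voters of $N$, for every profile $R$ on $N$; - neutral on $N$ if, for every profile $R$ on $N$ and every permutation $\pi$ of $A$, renaming the alternatives in $R$ along $\pi$ yields the lottery that assigns to $\pi(x)$ the probability that $f(R)$ assigns to $x$, for all $x\in A$; - PC-efficient on $N$ if for no profile $R$ on $N$ there is a lottery $p$ with $p \succsim_i^{PC} f(R)$ for all $i\in N$ and $p \succ_i^{PC}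 f(R)$ for some $i \in N$; - PC-manipulable on $N$ if it is not PC-strategyproof on $N$, i.e., if there are a voter $i\in N$ and profiles $R,R'$ on $N$ that coincide except possibly for the preference relation of voter $i$, such that not $f(R)\succsim_i^{PC} f(R')$, where $\succsim_i^{PC}$ refers to the preference relation of $i$ in $R$. Theorem. Let $N$ be an electorate with $|N|\ge 3$ and $|N|\notin\{4,6\}$. Every SDS that is anonymous, neutral, and PC-efficient on $N$ is PC-manipulable on $N$. In particular, every SDS that has these three properties on all electorates is PC-manipulable on each electorate $N$ with $|N|\ge 3$ and $|N|\notin\{4,6\}$. -/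

import Mathlib

/-- A preference relation on the set `A` of alternatives: a strict linear order without ties.
`r.prefers x y` means that `x` is strictly preferred to `y`. -/
structure PrefRel (A : Type*) where
  prefers : A → A → Prop
  irrefl : ∀ x, ¬ prefers x x
  trans : ∀ x y z, prefers x y → prefers y z → prefers x z
  total : ∀ x y, x ≠ y → prefers x y ∨ prefers y x

/-- The preference relation obtained by renaming the alternatives along `π`:
`π x` is preferred to `π y` in `r.rename π` iff `x` is preferred to `y` in `r`. -/
def PrefRel.rename {A : Type*} (π : Equiv.Perm A) (r : PrefRel A) : PrefRel A where
  prefers x y := r.prefers (π.symm x) (π.symm y)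
  irrefl x := r.irrefl _
  trans x y z := r.trans _ _ _
  total x y h := r.total _ _ (fun h' => h (π.symm.injective h'))

/-- An electorate: a finite non-empty set of voters from `{1, 2, 3, …}`. -/
abbrev Electorate : Type := {N : Finset ℕ+ // N.Nonempty}

/-- A preference profile on the electorate `N`. -/
abbrev Profile (A : Type*) (N : Electorate) : Type _ := {i : ℕ+ // i ∈ N.1} → PrefRel A

/-- A lottery over the finite set `A` of alternatives. -/
abbrev Lottery (A : Type*) [Fintype A] : Type _ := {p : A → ℝ // p ∈ stdSimplex ℝ A}

/-- A social decision scheme maps every profile, on every electorate, to a lottery. -/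
abbrev SDS (A : Type*) [Fintype A] : Type _ := (N : Electorate) → Profile A N → Lottery A

section
variable {A : Type*} [Fintype A]

open Classical in
/-- The probability that independent draws `x` from `p` and `y` from `q` satisfy that `x` is
strictly preferred to `y`, i.e. the sum of `p x * q y` over all such pairs. -/
noncomputable def winProb (r : PrefRel A) (p q : Lottery A) : ℝ :=
  ∑ x : A, ∑ y : A, if r.prefers x y then p.1 x * q.1 y else 0

/-- Weak pairwise-comparison preference of `p` over `q`. -/
def PCPrefers (r : PrefRel A) (p q : Lottery A) : Prop :=
  winProb r p q ≥ winProb r q p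

/-- Strict pairwise-comparison preference of `p` over `q`. -/
def PCStrictlyPrefers (r : PrefRel A) (p q : Lottery A) : Prop :=
  PCPrefers r p q ∧ ¬ PCPrefers r q p

/-- The lottery `p` PC-dominates the lottery `q` in the profile `R`. -/
def PCDominates {N : Electorate} (R : Profile A N) (p q : Lottery A) : Prop :=
  (∀ i, PCPrefers (R i) p q) ∧ ∃ i, PCStrictlyPrefers (R i) p q

/-- The lottery `q` is PC-efficient in the profile `R`. -/
def PCEfficientLottery {N : Electorate} (R : Profile A N) (q : Lottery A) : Prop :=
  ¬ ∃ p : Lottery A, PCDominates R p q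

/-- Anonymity for the electorate `N`: permuting the voters of `N` does not change the outcome. -/
def SDS.AnonymousOn (f : SDS A) (N : Electorate) : Prop :=
  ∀ (R : Profile A N) (π : Equiv.Perm {i : ℕ+ // i ∈ N.1}), f N (fun i => R (π i)) = f N R

/-- Neutrality for the electorate `N`: renaming the alternatives renames the outcome. -/
def SDS.NeutralOn (f : SDS A) (N : Electorate) : Prop :=
  ∀ (R : Profile A N) (π : Equiv.Perm A) (x : A),
    (f N (fun i => (R i).rename π)).1 (π x) = (f N R).1 x

/-- PC-efficiency for the electorate `N`. -/
def SDS.PCEfficientOn (f : SDS A) (N : Electorate) : Prop :=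
  ∀ R : Profile A N, PCEfficientLottery R (f N R)

/-- PC-strategyproofness for the electorate `N`: no voter, with true preferences `R i`, fails to
weakly prefer the outcome of `R` to the outcome after his unilateral misreport. -/
def SDS.PCStrategyproofOn (f : SDS A) (N : Electorate) : Prop :=
  ∀ (i : {i : ℕ+ // i ∈ N.1}) (R R' : Profile A N),
    (∀ j, j ≠ i → R j = R' j) → PCPrefers (R i) (f N R) (f N R')

/-- PC-manipulability for the electorate `N`. -/
def SDS.PCManipulableOn (f : SDS A) (N : Electorate) : Prop :=
  ¬ f.PCStrategyproofOn N

end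

/-! Suppose a scheme has all four properties. Fix four alternatives that every voter ranks above the
rest, in a common order of the rest. Pareto-dominated alternatives get probability 0, so on such
profiles the scheme amounts to a `Rule` on four alternatives, depending only on the multiset of
reported rankings. The rest shows that no `Rule` exists.

The first pillar is `majority`: the favourite of an absolute majority is elected with certainty.
Efficiency keeps two rival camps, both ranking 3 second, from both getting probability when 3 has
supporters. If a minority camp for 0 got something, it would keep it while an equally large camp for
1 is built up, and exchanging 0 and 1 gives a contradiction. A degenerate outcome then survives
changes by voters who rank it last, and changes that put it first.

Write n = 2K + c with c = 1 or c = 2. With K voters on each side, a single voter (or one of two) can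
create a majority, and strategyproofness turns this threat into inequalities between probabilities
(`two_le_zero`, `one_le_two`, `one_le_three`). On the Condorcet cycle of 0, 1, 2 these inequalities
and rotational symmetry force the uniform lottery (`cyc_uniform`).

Moving 3 to the top of the last c ballots leaves 3 at probability 0 and preserves the equality of 1
and 2 (`base_odcab`). If these voters instead report `odabc`, then 2 gets 0 and 3 gets at least as
much as 1 (`one_le_three`). Passing from `odcab` to `odabc` is then a profitable manipulation for
one of the c voters (`false_of_le`). -/

/-- A ranking of four alternatives: `o i` is the alternative in position `i`, position `0` being
the best one. -/
abbrev Ranking : Type := Equiv.Perm (Fin 4)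

/-- The contribution of the pair `x`, `y` to the advantage of `p` over `q`. -/
def bracket (p q : Fin 4 → ℝ) (x y : Fin 4) : ℝ := p x * q y - q x * p y

/-- The pairwise-comparison advantage of `p` over `q` for the ranking `o`. -/
def phi (o : Ranking) (p q : Fin 4 → ℝ) : ℝ :=
  bracket p q (o 0) (o 1) + bracket p q (o 0) (o 2) + bracket p q (o 0) (o 3) +
  bracket p q (o 1) (o 2) + bracket p q (o 1) (o 3) + bracket p q (o 2) (o 3)

/-- `x` is ranked above `y` in `o`. -/
def Above (o : Ranking) (x y : Fin 4) : Prop := ∃ i j, i < j ∧ o i = x ∧ o j = y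

instance (o : Ranking) (x y : Fin 4) : Decidable (Above o x y) := by
  unfold Above; infer_instance

/-- The restriction of an anonymous, neutral, efficient and strategyproof social decision scheme
to four alternatives and `n` voters, as a function of the multiset of reported rankings. -/
structure Rule (n : ℕ) where
  F : Multiset Ranking → Fin 4 → ℝ
  nonneg : ∀ s, s.card = n → ∀ i, 0 ≤ F s i
  sum_one : ∀ s, s.card = n → F s 0 + F s 1 + F s 2 + F s 3 = 1
  neutral : ∀ s, s.card = n → ∀ (π : Ranking) (i : Fin 4), F (s.map (π * ·)) (π i) = F s i
  sp : ∀ t : Multiset Ranking, t.card + 1 = n → ∀ o o' : Ranking,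
    0 ≤ phi o (F ({o} + t)) (F ({o'} + t))
  eff : ∀ s, s.card = n → ∀ p : Fin 4 → ℝ, (∀ i, 0 ≤ p i) → p 0 + p 1 + p 2 + p 3 = 1 →
    (∀ o ∈ s, 0 ≤ phi o p (F s)) → ∀ o ∈ s, phi o p (F s) ≤ 0
  pareto : ∀ s, s.card = n → ∀ x y, (∀ o ∈ s, Above o x y) → F s y = 0

/-! ### Nine rankings, spelled from best to worst with a, b, c, d for 0, 1, 2, 3 -/

def oabcd : Ranking := ⟨![0, 1, 2, 3], ![0, 1, 2, 3], by decide, by decide⟩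
def oadbc : Ranking := ⟨![0, 3, 1, 2], ![0, 2, 3, 1], by decide, by decide⟩
def obdac : Ranking := ⟨![1, 3, 0, 2], ![2, 0, 3, 1], by decide, by decide⟩
def odbac : Ranking := ⟨![3, 1, 0, 2], ![2, 1, 3, 0], by decide, by decide⟩
def odabc : Ranking := ⟨![3, 0, 1, 2], ![1, 2, 3, 0], by decide, by decide⟩
def obcad : Ranking := ⟨![1, 2, 0, 3], ![2, 0, 1, 3], by decide, by decide⟩
def obcda : Ranking := ⟨![1, 2, 3, 0], ![3, 0, 1, 2], by decide, by decide⟩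
def ocabd : Ranking := ⟨![2, 0, 1, 3], ![1, 2, 0, 3], by decide, by decide⟩
def odcab : Ranking := ⟨![3, 2, 0, 1], ![2, 3, 1, 0], by decide, by decide⟩

lemma phi_oabcd (p q : Fin 4 → ℝ) : phi oabcd p q =
    bracket p q 0 1 + bracket p q 0 2 + bracket p q 0 3 + bracket p q 1 2 + bracket p q 1 3 +
      bracket p q 2 3 := rfl
lemma phi_oadbc (p q : Fin 4 → ℝ) : phi oadbc p q =
    bracket p q 0 3 + bracket p q 0 1 + bracket p q 0 2 + bracket p q 3 1 + bracket p q 3 2 +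
      bracket p q 1 2 := rfl
lemma phi_obdac (p q : Fin 4 → ℝ) : phi obdac p q =
    bracket p q 1 3 + bracket p q 1 0 + bracket p q 1 2 + bracket p q 3 0 + bracket p q 3 2 +
      bracket p q 0 2 := rfl
lemma phi_odbac (p q : Fin 4 → ℝ) : phi odbac p q =
    bracket p q 3 1 + bracket p q 3 0 + bracket p q 3 2 + bracket p q 1 0 + bracket p q 1 2 +
      bracket p q 0 2 := rfl
lemma phi_odabc (p q : Fin 4 → ℝ) : phi odabc p q =
    bracket p q 3 0 + bracket p q 3 1 + bracket p q 3 2 + bracket p q 0 1 + bracket p q 0 2 +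
      bracket p q 1 2 := rfl
lemma phi_obcad (p q : Fin 4 → ℝ) : phi obcad p q =
    bracket p q 1 2 + bracket p q 1 0 + bracket p q 1 3 + bracket p q 2 0 + bracket p q 2 3 +
      bracket p q 0 3 := rfl
lemma phi_obcda (p q : Fin 4 → ℝ) : phi obcda p q =
    bracket p q 1 2 + bracket p q 1 3 + bracket p q 1 0 + bracket p q 2 3 + bracket p q 2 0 +
      bracket p q 3 0 := rfl
lemma phi_ocabd (p q : Fin 4 → ℝ) : phi ocabd p q =
    bracket p q 2 0 + bracket p q 2 1 + bracket p q 2 3 + bracket p q 0 1 + bracket p q 0 3 +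
      bracket p q 1 3 := rfl
lemma phi_odcab (p q : Fin 4 → ℝ) : phi odcab p q =
    bracket p q 3 2 + bracket p q 3 0 + bracket p q 3 1 + bracket p q 2 0 + bracket p q 2 1 +
      bracket p q 0 1 := rfl

lemma sum_ord (o : Ranking) (p : Fin 4 → ℝ) : p (o 0) + p (o 1) + p (o 2) + p (o 3) =
    p 0 + p 1 + p 2 + p 3 := by
  have := Equiv.sum_comp o p
  simpa [Fin.sum_univ_four] using this

lemma eq_zero_of_eq_one {p : Fin 4 → ℝ} (h0 : ∀ i, 0 ≤ p i) (h1 : p 0 + p 1 + p 2 + p 3 = 1)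
    {x : Fin 4} (hx : p x = 1) {y : Fin 4} (hy : y ≠ x) : p y = 0 := by
  have a0 := h0 0
  have a1 := h0 1
  have a2 := h0 2
  have a3 := h0 3
  fin_cases x <;> fin_cases y <;>
    first
    | exact absurd rfl hy
    | (simp only [Fin.zero_eta, Fin.mk_one, Fin.reduceFinMk] at hx ⊢; linarith)

/-! ### Stability of degenerate outcomes under changes of reports -/

namespace Rule

variable {n : ℕ} (G : Rule n)

lemma sp' {s s' : Multiset Ranking} (o o' : Ranking) (t : Multiset Ranking) (hs : s = {o} + t)
    (hs' : s' = {o'} + t) (hn : s.card = n) : 0 ≤ phi o (G.F s) (G.F s') := by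
  subst hs hs'
  exact G.sp t (by simp at hn; omega) o o'

/-- A voter with true ranking `o'` could report `o` and obtain the favourite for certain, so truth
must already yield it. -/
lemma stable_top {t : Multiset Ranking} (ht : t.card + 1 = n) {o o' : Ranking} {x : Fin 4}
    (h : G.F ({o} + t) x = 1) (hx : o' 0 = x) : G.F ({o'} + t) x = 1 := by
  have hsp := G.sp t ht o' o
  have c1 : ({o} + t).card = n := by simp; omega
  have c2 : ({o'} + t).card = n := by simp; omega
  have hz : ∀ i, i ≠ 0 → G.F ({o} + t) (o' i) = 0 := fun i hi =>
    eq_zero_of_eq_one (G.nonneg _ c1) (G.sum_one _ c1) h (by rw [← hx]; simpa using hi)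
  have hs := (sum_ord o' (G.F ({o'} + t))).trans (G.sum_one _ c2)
  subst hx
  have n1 := G.nonneg _ c2 (o' 1)
  have n2 := G.nonneg _ c2 (o' 2)
  have n3 := G.nonneg _ c2 (o' 3)
  simp only [phi, bracket, h, hz 1 (by decide), hz 2 (by decide), hz 3 (by decide)] at hsp
  linarith

/-- The voter already receives the worst lottery for `o`; any other outcome after the change would
be a gain. -/
lemma stable_bottom {t : Multiset Ranking} (ht : t.card + 1 = n) {o : Ranking} (o' : Ranking)
    {x : Fin 4} (h : G.F ({o} + t) x = 1) (hx : o 3 = x) : G.F ({o'} + t) x = 1 := by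
  have hsp := G.sp t ht o o'
  have c1 : ({o} + t).card = n := by simp; omega
  have c2 : ({o'} + t).card = n := by simp; omega
  have hz : ∀ i, i ≠ 3 → G.F ({o} + t) (o i) = 0 := fun i hi =>
    eq_zero_of_eq_one (G.nonneg _ c1) (G.sum_one _ c1) h (by rw [← hx]; simpa using hi)
  have hs := (sum_ord o (G.F ({o'} + t))).trans (G.sum_one _ c2)
  subst hx
  have n1 := G.nonneg _ c2 (o 0)
  have n2 := G.nonneg _ c2 (o 1)
  have n3 := G.nonneg _ c2 (o 2)
  simp only [phi, bracket, h, hz 0 (by decide), hz 1 (by decide), hz 2 (by decide)] at hsp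
  linarith

/-- Voters who all rank `x` last may change their reports arbitrarily. -/
lemma stable_bottoms {x : Fin 4} {o : Ranking} (hx : o 3 = x) (u : Multiset Ranking) :
    ∀ t : Multiset Ranking, u.card + t.card = n → G.F (u.card • {o} + t) x = 1 →
      G.F (u + t) x = 1 := by
  induction u using Multiset.induction with
  | empty => intro t _ h; simpa using h
  | cons a u ih =>
    intro t hc h
    have hc' : u.card + t.card + 1 = n := by simp at hc; omega
    have h1 : G.F ({a} + (u.card • {o} + t)) x = 1 := by
      refine G.stable_bottom (o := o) (by simp; omega) a ?_ hx
      rw [← h]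
      congr 1
      simp only [Multiset.card_cons, add_smul, one_smul]
      abel
    have h2 := ih ({a} + t) (by simp; omega) (by rw [← h1]; congr 1; abel)
    rw [← h2]
    congr 1
    rw [← Multiset.singleton_add]
    abel

/-- Voters may rearrange their reports below `x`. -/
lemma stable_tops {x : Fin 4} (o : Ranking) (u : Multiset Ranking) (hu : ∀ o' ∈ u, o' 0 = x) :
    ∀ t : Multiset Ranking, u.card + t.card = n → G.F (u.card • {o} + t) x = 1 →
      G.F (u + t) x = 1 := by
  induction u using Multiset.induction with
  | empty => intro t _ h; simpa using h
  | cons a u ih =>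
    intro t hc h
    have hc' : u.card + t.card + 1 = n := by simp at hc; omega
    have h1 : G.F ({a} + (u.card • {o} + t)) x = 1 := by
      refine G.stable_top (o := o) (by simp; omega) ?_ (hu a (by simp))
      rw [← h]
      congr 1
      simp only [Multiset.card_cons, add_smul, one_smul]
      abel
    have h2 := ih (fun o' ho' => hu o' (by simp [ho'])) ({a} + t) (by simp; omega)
      (by rw [← h1]; congr 1; abel)
    rw [← h2]
    congr 1
    rw [← Multiset.singleton_add]
    abel

end Rule

/-! ### Absolute majorities -/

namespace Rule

variable {n : ℕ} (G : Rule n)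

/-- Supporters of `0`, supporters of `1`, and two kinds of supporters of `3`, where the supporters
of `0` and `1` rank `3` second and `2` is last for everybody. -/
def star (i j r s : ℕ) : Multiset Ranking :=
  i • {oadbc} + j • {obdac} + r • {odbac} + s • {odabc}

lemma card_star (i j r s : ℕ) : (star i j r s).card = i + j + r + s := by
  simp [star]

lemma mem_star {i j r s : ℕ} {o : Ranking} (h : o ∈ star i j r s) :
    o = oadbc ∨ o = obdac ∨ o = odbac ∨ o = odabc := by
  simp only [star, Multiset.mem_add, Multiset.mem_nsmul, Multiset.mem_singleton] at h
  tauto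

lemma star_two {i j r s : ℕ} (h : i + j + r + s = n) : G.F (star i j r s) 2 = 0 := by
  refine G.pareto _ (by rw [card_star, h]) 3 2 fun o ho => ?_
  rcases mem_star ho with rfl | rfl | rfl | rfl <;> decide

lemma star_zero_or_one {i j r s : ℕ} (h : i + j + r + s = n) (hrs : 0 < r + s) :
    G.F (star i j r s) 0 = 0 ∨ G.F (star i j r s) 1 = 0 := by
  by_contra hcon
  push Not at hcon
  have hc : (star i j r s).card = n := by rw [card_star, h]
  have h2 := G.star_two h
  have hsum := G.sum_one _ hc
  have ha := lt_of_le_of_ne (G.nonneg _ hc 0) hcon.1.symm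
  have hb := lt_of_le_of_ne (G.nonneg _ hc 1) hcon.2.symm
  have hd := G.nonneg _ hc 3
  have heff := G.eff _ hc
  generalize G.F (star i j r s) = q at *
  set a := q 0
  set b := q 1
  set d := q 3
  rw [h2] at hsum
  have hab : 0 < a * b := mul_pos ha hb
  -- Mass moves from 0 and 1 to 3 in the ratio b + d to a + d, which leaves the supporters of 0 and
  -- of 1 exactly indifferent, while supporters of 3 gain strictly. The factor a * b keeps the
  -- entries nonnegative.
  specialize heff ![a - a * b * (b + d), b - a * b * (a + d), 0, d + a * b * (a + b + 2 * d)]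
    (by
      intro i
      fin_cases i <;> simp only [Fin.zero_eta, Fin.mk_one, Fin.reduceFinMk, Matrix.cons_val]
      · have : a - a * b * (b + d) = a * ((1 - b) + b * (1 - (b + d))) := by ring
        rw [this]
        exact mul_nonneg ha.le (add_nonneg (by linarith) (mul_nonneg hb.le (by linarith)))
      · have : b - a * b * (a + d) = b * ((1 - a) + a * (1 - (a + d))) := by ring
        rw [this]
        exact mul_nonneg hb.le (add_nonneg (by linarith) (mul_nonneg ha.le (by linarith)))
      · exact le_rfl
      · positivity)
    (by simp only [Matrix.cons_val]; linear_combination hsum)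
  have key : 0 < a * b * (2 * a * b + b ^ 2 + b ^ 2 + 2 * a * d + 4 * b * d + 2 * d ^ 2) := by
    positivity
  have key' : 0 < a * b * (2 * a * b + a ^ 2 + a ^ 2 + 2 * b * d + 4 * a * d + 2 * d ^ 2) := by
    positivity
  have hD : 0 < phi odbac
      ![a - a * b * (b + d), b - a * b * (a + d), 0, d + a * b * (a + b + 2 * d)] q := by
    refine lt_of_lt_of_eq key ?_
    simp only [phi_odbac, bracket, Matrix.cons_val, h2]
    ring
  have hD' : 0 < phi odabc
      ![a - a * b * (b + d), b - a * b * (a + d), 0, d + a * b * (a + b + 2 * d)] q := by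
    refine lt_of_lt_of_eq key' ?_
    simp only [phi_odabc, bracket, Matrix.cons_val, h2]
    ring
  have hall := heff (by
    intro o ho
    rcases mem_star ho with rfl | rfl | rfl | rfl
    · refine le_of_eq ?_
      simp only [phi_oadbc, bracket, Matrix.cons_val, h2]
      ring
    · refine le_of_eq ?_
      simp only [phi_obdac, bracket, Matrix.cons_val, h2]
      ring
    · exact hD.le
    · exact hD'.le)
  rcases Nat.eq_zero_or_pos r with hr | hr
  · have hs : s ≠ 0 := by omega
    have := hall odabc (by simp [star, Multiset.mem_nsmul, hs])
    linarith
  · have := hall odbac (by simp [star, Multiset.mem_nsmul, hr.ne'])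
    linarith

lemma swap_oadbc : (Equiv.swap 0 1 : Ranking) * oadbc = obdac := by decide
lemma swap_obdac : (Equiv.swap 0 1 : Ranking) * obdac = oadbc := by decide
lemma swap_odbac : (Equiv.swap 0 1 : Ranking) * odbac = odabc := by decide
lemma swap_odabc : (Equiv.swap 0 1 : Ranking) * odabc = odbac := by decide

lemma star_swap {i j r s : ℕ} (h : i + j + r + s = n) (x : Fin 4) :
    G.F (star j i s r) (Equiv.swap 0 1 x) = G.F (star i j r s) x := by
  rw [← G.neutral (star i j r s) (by rw [card_star, h]) (Equiv.swap 0 1) x]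
  congr 1
  simp only [star, Multiset.map_add, Multiset.map_nsmul, Multiset.map_singleton, swap_oadbc,
    swap_obdac, swap_odbac, swap_odabc]
  abel_nf

/-- The probability of `0` if `j` voters report `oadbc` and the others report `odbac`. -/
noncomputable def weight (j : ℕ) : ℝ := G.F (star j 0 (n - j) 0) 0

lemma star_one {i r s : ℕ} (h : i + r + s = n) : G.F (star i 0 r s) 1 = 0 := by
  refine G.pareto _ (by rw [card_star]; omega) 3 1 fun o ho => ?_
  simp only [star, Multiset.mem_add, Multiset.mem_nsmul, Multiset.mem_singleton] at ho
  rcases ho with ((⟨_, rfl⟩ | ⟨h, _⟩) | ⟨_, rfl⟩) | ⟨_, rfl⟩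
  · decide
  · exact absurd rfl h
  · decide
  · decide

/-- The two kinds of supporters of 3 differ only on 0 and 1. Since 1 and 2 have probability 0, both
kinds compare these outcomes by the probability of 3, so neither report can be better than the
other. -/
lemma star_weight (j s : ℕ) : ∀ r, j + r + s = n → G.F (star j 0 r s) 0 = G.weight j := by
  induction s with
  | zero =>
    intro r h
    rw [weight, show n - j = r by omega]
  | succ s ih =>
    intro r h
    rw [← ih (r + 1) (by omega)]
    have e1 : star j 0 r (s + 1) = {odabc} + star j 0 r s := by
      simp only [star, add_smul, one_smul]; abel
    have e2 : star j 0 (r + 1) s = {odbac} + star j 0 r s := by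
      simp only [star, add_smul, one_smul]; abel
    have c1 : (star j 0 r (s + 1)).card = n := by rw [card_star]; omega
    have c2 : (star j 0 (r + 1) s).card = n := by rw [card_star]; omega
    have p1 := G.sp' _ _ _ e1 e2 c1
    have p2 := G.sp' _ _ _ e2 e1 c2
    have s1 := G.sum_one _ c1
    have s2 := G.sum_one _ c2
    rw [G.star_two (by omega), G.star_one (by omega)] at s1 s2
    simp only [phi_odabc, phi_odbac, bracket, G.star_two (show j + 0 + r + (s + 1) = n by omega),
      G.star_one (show j + r + (s + 1) = n by omega),
      G.star_two (show j + 0 + (r + 1) + s = n by omega),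
      G.star_one (show j + (r + 1) + s = n by omega)] at p1 p2
    have s1' : G.F (star j 0 r (s + 1)) 3 = 1 - G.F (star j 0 r (s + 1)) 0 := by linarith
    have s2' : G.F (star j 0 (r + 1) s) 3 = 1 - G.F (star j 0 (r + 1) s) 0 := by linarith
    rw [s1', s2'] at p1 p2
    linarith

lemma weight_le_succ {j : ℕ} (h : j + 1 ≤ n) : G.weight j ≤ G.weight (j + 1) := by
  obtain ⟨r, rfl⟩ : ∃ r, n = j + 1 + r := ⟨n - (j + 1), by omega⟩
  rw [← G.star_weight j 0 (r + 1) (by omega), ← G.star_weight (j + 1) 0 r (by omega)]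
  have e1 : star (j + 1) 0 r 0 = {oadbc} + star j 0 r 0 := by
    simp only [star, add_smul, one_smul]; abel
  have e2 : star j 0 (r + 1) 0 = {odbac} + star j 0 r 0 := by
    simp only [star, add_smul, one_smul]; abel
  have c1 : (star (j + 1) 0 r 0).card = j + 1 + r := by rw [card_star]; omega
  have c2 : (star j 0 (r + 1) 0).card = j + 1 + r := by rw [card_star]; omega
  have p1 := G.sp' _ _ _ e1 e2 c1
  have s1 := G.sum_one _ c1
  have s2 := G.sum_one _ c2
  have t1 := G.star_two (show j + 1 + 0 + r + 0 = j + 1 + r by omega)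
  have t2 := G.star_one (show j + 1 + r + 0 = j + 1 + r by omega)
  have t3 := G.star_two (show j + 0 + (r + 1) + 0 = j + 1 + r by omega)
  have t4 := G.star_one (show j + (r + 1) + 0 = j + 1 + r by omega)
  rw [t1, t2] at s1
  rw [t3, t4] at s2
  simp only [phi_oadbc, bracket, t1, t2, t3, t4] at p1
  have s1' : G.F (star (j + 1) 0 r 0) 3 = 1 - G.F (star (j + 1) 0 r 0) 0 := by linarith
  have s2' : G.F (star j 0 (r + 1) 0) 3 = 1 - G.F (star j 0 (r + 1) 0) 0 := by linarith
  rw [s1', s2'] at p1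
  linarith

lemma weight_mono {j i : ℕ} (hj : j ≤ i) (hi : i ≤ n) : G.weight j ≤ G.weight i := by
  induction i, hj using Nat.le_induction with
  | base => exact le_rfl
  | succ i _ ih => exact (ih (by omega)).trans (G.weight_le_succ hi)

/-- If the supporters of `1` obtain anything, then they obtain what they would obtain without any
supporters of `0`. -/
lemma star_one_eq_weight (i : ℕ) : ∀ j r s, i + j + r + s = n → 0 < r + s →
    0 < G.F (star i j r s) 1 → G.F (star i j r s) 1 = G.weight j := by
  induction i with
  | zero =>
    intro j r s h _ _
    rw [← G.star_weight j r s (by omega)]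
    have := G.star_swap (show j + 0 + s + r = n by omega) 0
    rwa [Equiv.swap_apply_left] at this
  | succ i ih =>
    intro j r s h hrs hpos
    have e1 : star (i + 1) j r s = {oadbc} + star i j r s := by
      simp only [star, add_smul, one_smul]; abel
    have e2 : star i j (r + 1) s = {odbac} + star i j r s := by
      simp only [star, add_smul, one_smul]; abel
    have c1 : (star (i + 1) j r s).card = n := by rw [card_star]; omega
    have c2 : (star i j (r + 1) s).card = n := by rw [card_star]; omega
    have p1 := G.sp' _ _ _ e1 e2 c1
    have p2 := G.sp' _ _ _ e2 e1 c2
    have s1 := G.sum_one _ c1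
    have s2 := G.sum_one _ c2
    have t1 := G.star_two h
    have t2 := G.star_two (show i + j + (r + 1) + s = n by omega)
    have t3 := (G.star_zero_or_one h hrs).resolve_right hpos.ne'
    have ih' := ih j (r + 1) s (by omega) (by omega)
    have n0 := G.nonneg _ c2 0
    have n1 := G.nonneg _ c2 1
    have n3 := G.nonneg _ c1 3
    have hor := G.star_zero_or_one (show i + j + (r + 1) + s = n by omega) (by omega)
    generalize G.F (star (i + 1) j r s) = q at *
    generalize G.F (star i j (r + 1) s) = q' at *
    simp only [phi_oadbc, phi_odbac, bracket, t1, t2, t3] at p1 p2 s1 s2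
    have s1' : q 3 = 1 - q 1 := by linarith
    -- Otherwise `q'` lies on 0 and 3 while `q` lies on 1 and 3 with `q 1 > 0`, and the `oadbc`
    -- voter would gain by reporting `odbac`. Once both lotteries lie on 1 and 3, which both
    -- rankings order alike, they coincide.
    have hq' : 0 < q' 1 := by
      rcases hor with h0 | h1
      · rcases n1.lt_or_eq with hlt | heq
        · exact hlt
        · have s2' : q' 3 = 1 := by linarith
          rw [s1', s2', h0, ← heq] at p1
          linarith
      · have s2' : q' 3 = 1 - q' 0 := by linarith
        rw [s2', h1, s1'] at p1
        rw [s1'] at n3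
        nlinarith [mul_nonneg n0 n3]
    rw [← ih' hq']
    have h0 := hor.resolve_right hq'.ne'
    have s2' : q' 3 = 1 - q' 1 := by linarith
    rw [s1', s2', h0] at p1 p2
    linarith

/-- If 1 got a positive amount, at most α, then 0 would get nothing, and the `odbac` voter would
profit, since mass would move from 0 to 1 or 3. So both lotteries lie on 0 and 3; both rankings
prefer 3 to 0, hence nothing changes. -/
lemma star_step {s s' : Multiset Ranking} {o' : Ranking} {t : Multiset Ranking} {α : ℝ}
    (e : s = {odbac} + t) (e' : s' = {o'} + t) (ho' : o' = obdac ∨ o' = odabc) (hs : s.card = n)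
    (h2 : G.F s 2 = 0) (h2' : G.F s' 2 = 0) (hα : 0 < α) (h0 : G.F s 0 = α) (h1 : G.F s 1 = 0)
    (h01 : G.F s' 0 = 0 ∨ G.F s' 1 = 0) (hle : 0 < G.F s' 1 → G.F s' 1 ≤ α) :
    G.F s' 0 = α ∧ G.F s' 1 = 0 := by
  have hs' : s'.card = n := by rw [e', ← hs, e]; simp
  have p1 := G.sp' _ _ _ e e' hs
  have p2 := G.sp' _ _ _ e' e hs'
  have s1 := G.sum_one _ hs
  have s2 := G.sum_one _ hs'
  have n1 := G.nonneg _ hs' 1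
  generalize G.F s = q at *
  generalize G.F s' = q' at *
  have s1' : q 3 = 1 - α := by linarith
  simp only [phi_odbac, bracket, h0, h1, h2, h2', s1'] at p1
  rcases n1.lt_or_eq with hlt | heq
  · have hz := h01.resolve_right hlt.ne'
    have s2' : q' 3 = 1 - q' 1 := by linarith
    rw [hz, s2'] at p1
    nlinarith [mul_pos hlt hα, hle hlt]
  · have s2' : q' 3 = 1 - q' 0 := by linarith
    rw [s2', ← heq] at p1
    refine ⟨?_, heq.symm⟩
    rcases ho' with rfl | rfl
    · simp only [phi_obdac, bracket, h0, h1, h2, h2', s1', s2', ← heq] at p2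
      linarith
    · simp only [phi_odabc, bracket, h0, h1, h2, h2', s1', s2', ← heq] at p2
      linarith

/-- A minority supporting `0` cannot give any probability to `0`. -/
lemma weight_eq_zero {i : ℕ} (hi : 2 * i < n) : G.weight i = 0 := by
  by_contra hne
  have hα : 0 < G.weight i := lt_of_le_of_ne
    (G.nonneg _ (by rw [card_star]; omega) 0) (Ne.symm hne)
  -- Supporters of 3 become supporters of 1 one at a time, up to i of them. By monotonicity of
  -- `weight`, the camp for 1 could never obtain more than `weight i`.
  have ha : ∀ j r, j ≤ i → i + j + r = n →
      G.F (star i j r 0) 0 = G.weight i ∧ G.F (star i j r 0) 1 = 0 := by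
    intro j
    induction j with
    | zero => exact fun r _ h => ⟨G.star_weight i 0 r (by omega), G.star_one (by omega)⟩
    | succ j ih =>
      intro r hj h
      obtain ⟨h0, h1⟩ := ih (r + 1) (by omega) (by omega)
      refine G.star_step (t := star i j r 0) (o' := obdac) ?_ ?_ (Or.inl rfl) ?_
        (G.star_two (by omega)) (G.star_two (by omega)) hα h0 h1
        (G.star_zero_or_one (by omega) (by omega)) fun hpos => ?_
      · simp only [star, add_smul, one_smul]; abel
      · simp only [star, add_smul, one_smul]; abel
      · rw [card_star]; omega
      · rw [G.star_one_eq_weight i (j + 1) r 0 (by omega) (by omega) hpos]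
        exact G.weight_mono hj (by omega)
  -- The remaining supporters of 3 turn from `odbac` to `odabc`, which reaches the mirror image of
  -- the starting profile under exchanging 0 and 1.
  have hb : ∀ m r, i + i + r + m = n →
      G.F (star i i r m) 0 = G.weight i ∧ G.F (star i i r m) 1 = 0 := by
    intro m
    induction m with
    | zero => exact fun r h => ha i r le_rfl (by omega)
    | succ m ih =>
      intro r h
      obtain ⟨h0, h1⟩ := ih (r + 1) (by omega)
      refine G.star_step (t := star i i r m) (o' := odabc) ?_ ?_ (Or.inr rfl) ?_
        (G.star_two (by omega)) (G.star_two (by omega)) hα h0 h1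
        (G.star_zero_or_one (by omega) (by omega)) fun hpos => ?_
      · simp only [star, add_smul, one_smul]; abel
      · simp only [star, add_smul, one_smul]; abel
      · rw [card_star]; omega
      · exact (G.star_one_eq_weight i i r (m + 1) (by omega) (by omega) hpos).le
  have h := G.star_swap (show i + i + (n - 2 * i) + 0 = n by omega) 0
  rw [Equiv.swap_apply_left, (hb (n - 2 * i) 0 (by omega)).2, (hb 0 (n - 2 * i) (by omega)).1] at h
  exact hne h.symm

/-- Moves 3 to the bottom of the minority's ballots, so that `stable_bottoms` can later replace them
by anything. Along the way 0 dominates 1 and 2, so a departure from 3 could only favour 0, which the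
deviating `oadbc` voter would welcome. -/
lemma majority_aux {i l : ℕ} (h : i + l = n) (hil : i < l) : ∀ k m, k + m = i →
    G.F (k • {oabcd} + m • {oadbc} + l • {odabc}) 3 = 1 := by
  intro k
  induction k with
  | zero =>
    intro m hm
    have h0 : G.F (star i 0 0 l) 0 = 0 := by
      rw [G.star_weight i l 0 (by omega), G.weight_eq_zero (by omega)]
    have hs := G.sum_one (star i 0 0 l) (by rw [card_star]; omega)
    rw [h0, G.star_two (by omega), G.star_one (by omega)] at hs
    obtain rfl : m = i := by omega
    rw [← show star m 0 0 l = 0 • {oabcd} + m • {oadbc} + l • {odabc} by simp [star]]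
    linarith
  | succ k ih =>
    intro m hm
    have ih' := ih (m + 1) (by omega)
    have hc : (k • {oabcd} + (m + 1) • {oadbc} + l • {odabc} : Multiset Ranking).card = n := by
      simp; omega
    have hc' : ((k + 1) • {oabcd} + m • {oadbc} + l • {odabc} : Multiset Ranking).card = n := by
      simp; omega
    have hp := G.sp' oadbc oabcd (k • {oabcd} + m • {oadbc} + l • {odabc})
      (s := k • {oabcd} + (m + 1) • {oadbc} + l • {odabc})
      (s' := (k + 1) • {oabcd} + m • {oadbc} + l • {odabc})
      (by simp only [add_smul, one_smul]; abel) (by simp only [add_smul, one_smul]; abel) hc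
    have hpar : ∀ y, y = 1 ∨ y = 2 →
        G.F ((k + 1) • {oabcd} + m • {oadbc} + l • {odabc}) y = 0 := by
      refine fun y hy => G.pareto _ hc' 0 y fun o ho => ?_
      simp only [Multiset.mem_add, Multiset.mem_nsmul, Multiset.mem_singleton] at ho
      rcases ho with (⟨_, rfl⟩ | ⟨_, rfl⟩) | ⟨_, rfl⟩ <;> rcases hy with rfl | rfl <;> decide
    have z := fun y hy => eq_zero_of_eq_one (G.nonneg _ hc) (G.sum_one _ hc) ih' (y := y) hy
    have hs := G.sum_one _ hc'
    have hn := G.nonneg _ hc' 0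
    simp only [phi_oadbc, bracket, hpar 1 (by simp), hpar 2 (by simp), ih', z 0 (by decide),
      z 1 (by decide), z 2 (by decide)] at hp hs
    linarith

/-- The rule elects the favourite alternative of an absolute majority. -/
theorem majority {x : Fin 4} {s₁ s₂ : Multiset Ranking} (hx : ∀ o ∈ s₁, o 0 = x)
    (hc : s₁.card + s₂.card = n) (hlt : s₂.card < s₁.card) : G.F (s₁ + s₂) x = 1 := by
  rw [← G.neutral _ (by simp [hc]) (Equiv.swap x 3) x, Equiv.swap_apply_left, Multiset.map_add]
  refine G.stable_tops odabc _ (fun o' ho' => ?_) _ (by simpa using hc) ?_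
  · obtain ⟨o, ho, rfl⟩ := Multiset.mem_map.1 ho'
    rw [Equiv.Perm.mul_apply, hx o ho, Equiv.swap_apply_left]
  · rw [add_comm]
    refine G.stable_bottoms (x := 3) (o := oabcd) rfl _ _ (by simp; omega) ?_
    simpa using G.majority_aux (i := s₂.card) (l := s₁.card) (by omega) hlt s₂.card 0 rfl

end Rule

/-! ### Inequalities from the threat of creating a majority -/

/-- The degenerate lottery on `x`. -/
def pure4 (x : Fin 4) : Fin 4 → ℝ := fun i => if i = x then 1 else 0

/-- Carries an inequality across one change of report on three alternatives. When a voter moves the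
alternative with coordinate z from first to last place, the two strategyproofness conditions say
that z - γ is at least |x * β - y * α|. -/
lemma le_of_wedge {x y z α β γ : ℝ} (hx : 0 ≤ x) (hy : 0 ≤ y)
    (h : x + y + z = 1) (h' : α + β + γ = 1) (hβγ : β ≤ γ) (h₁ : 0 ≤ z - γ + (x * β - y * α))
    (h₂ : 0 ≤ z - γ - (x * β - y * α)) : y ≤ z := by
  rcases (show γ ≤ 1 by linarith).lt_or_eq with hlt | heq
  · have : y * (1 - γ) ≤ z * (1 - γ) := by
      have e : y * (1 - γ) = y * α + y * β := by rw [← h']; ring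
      have e' : (x + y) * β ≤ (x + y) * γ := mul_le_mul_of_nonneg_left hβγ (by linarith)
      have e'' : (x + y) * γ = (1 - z) * γ := by rw [← h]; ring
      rw [e]
      nlinarith
    exact le_of_mul_le_mul_right this (by linarith)
  · linarith

namespace Rule

variable {n : ℕ} (G : Rule n)

/-- The voter `o` is pivotal: by ranking x first, this voter completes a majority for x. The
truthful outcome must be at least as good as x. -/
lemma phi_pure4_nonneg {s : Multiset Ranking} (o : Ranking) {x : Fin 4} (s₁ s₂ : Multiset Ranking)
    (hs : s = {o} + (s₁ + s₂)) (hx : ∀ o' ∈ s₁, o' 0 = x) (hc : s.card = n)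
    (hlt : s₂.card ≤ s₁.card) : 0 ≤ phi o (G.F s) (pure4 x) := by
  let o' : Ranking := Equiv.swap 0 x
  have hc' : s₁.card + s₂.card + 1 = n := by rw [← hc, hs]; simp
  have hp := G.sp' o o' (s₁ + s₂) hs rfl hc
  have h1 : G.F ({o'} + (s₁ + s₂)) x = 1 := by
    rw [← add_assoc]
    refine G.majority (fun o'' ho => ?_) (by simp; omega) (by simp; omega)
    rcases Multiset.mem_add.1 ho with h | h
    · rw [Multiset.mem_singleton.1 h]; exact Equiv.swap_apply_left 0 x
    · exact hx _ h
  have hcard : ({o'} + (s₁ + s₂)).card = n := by simp; omega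
  have e : G.F ({o'} + (s₁ + s₂)) = pure4 x := by
    funext i
    by_cases hi : i = x
    · rw [hi, h1, pure4, if_pos rfl]
    · rw [eq_zero_of_eq_one (G.nonneg _ hcard) (G.sum_one _ hcard) h1 hi, pure4, if_neg hi]
  rwa [e] at hp

lemma gap_oabcd {s s₁ s₂ : Multiset Ranking} (hs : s = {oabcd} + (s₁ + s₂))
    (hx : ∀ o ∈ s₁, o 0 = 1) (hc : s.card = n) (hlt : s₂.card ≤ s₁.card) :
    G.F s 2 + G.F s 3 ≤ G.F s 0 := by
  have h := G.phi_pure4_nonneg oabcd s₁ s₂ hs hx hc hlt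
  simp [phi_oabcd, bracket, pure4] at h
  linarith

lemma gap_ocabd {s s₁ s₂ : Multiset Ranking} (hs : s = {ocabd} + (s₁ + s₂))
    (hx : ∀ o ∈ s₁, o 0 = 0) (hc : s.card = n) (hlt : s₂.card ≤ s₁.card) :
    G.F s 1 + G.F s 3 ≤ G.F s 2 := by
  have h := G.phi_pure4_nonneg ocabd s₁ s₂ hs hx hc hlt
  simp [phi_ocabd, bracket, pure4] at h
  linarith

lemma gap_odabc {s s₁ s₂ : Multiset Ranking} (hs : s = {odabc} + (s₁ + s₂))
    (hx : ∀ o ∈ s₁, o 0 = 0) (hc : s.card = n) (hlt : s₂.card ≤ s₁.card) :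
    G.F s 1 + G.F s 2 ≤ G.F s 3 := by
  have h := G.phi_pure4_nonneg odabc s₁ s₂ hs hx hc hlt
  simp [phi_odabc, bracket, pure4] at h
  linarith

/-- `k` voters report `oabcd`, the others report `u` and `v`. -/
def mixed (k : ℕ) (u v : Multiset Ranking) : Multiset Ranking := k • {oabcd} + u + v

lemma card_mixed (k : ℕ) (u v : Multiset Ranking) : (mixed k u v).card = k + u.card + v.card := by
  simp [mixed]

variable {K c : ℕ}

/-- For c = 1 an `oabcd` voter can complete a majority for 1. For c = 2 one `oabcd` voter is first
switched to `obcad`, a second one is then pivotal, and `le_of_wedge` brings the inequality back.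
This requires two such voters, hence c ≤ K. -/
lemma two_le_zero (hn : 2 * K + c = n) (hc : c = 1 ∨ c = 2) (hK : c ≤ K) {u v : Multiset Ranking}
    (hu : u.card = K) (hv : v.card = c) (hu1 : ∀ o ∈ u, o 0 = 1) (hu3 : ∀ o ∈ u, Above o 2 3)
    (hv3 : ∀ o ∈ v, Above o 2 3) : G.F (mixed K u v) 2 ≤ G.F (mixed K u v) 0 := by
  obtain ⟨k, rfl⟩ : ∃ k, K = k + 1 := ⟨K - 1, by omega⟩
  have hcard : (mixed (k + 1) u v).card = n := by rw [card_mixed]; omega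
  rcases hc with rfl | rfl
  · have h := G.gap_oabcd (s := mixed (k + 1) u v) (s₁ := u) (s₂ := k • {oabcd} + v)
      (by simp only [mixed, add_smul, one_smul]; abel) hu1 hcard (by simp; omega)
    linarith [G.nonneg _ hcard 3]
  · obtain ⟨l, rfl⟩ : ∃ l, k = l + 1 := ⟨k - 1, by omega⟩
    have hcard' : (mixed (l + 1) (u + {obcad}) v).card = n := by rw [card_mixed]; simp; omega
    have h := G.gap_oabcd (s := mixed (l + 1) (u + {obcad}) v) (s₁ := u + {obcad})
      (s₂ := l • {oabcd} + v) (by simp only [mixed, add_smul, one_smul]; abel)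
      (fun o ho => by
        rcases Multiset.mem_add.1 ho with h | h
        · exact hu1 o h
        · rw [Multiset.mem_singleton.1 h]; rfl) hcard' (by simp; omega)
    have e1 : mixed (l + 1 + 1) u v = {oabcd} + ((l + 1) • {oabcd} + u + v) := by
      simp only [mixed, add_smul, one_smul]; abel
    have e2 : mixed (l + 1) (u + {obcad}) v = {obcad} + ((l + 1) • {oabcd} + u + v) := by
      simp only [mixed, add_smul, one_smul]; abel
    have p1 := G.sp' _ _ _ e1 e2 hcard
    have p2 := G.sp' _ _ _ e2 e1 hcard'
    have z1 : G.F (mixed (l + 1 + 1) u v) 3 = 0 := by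
      refine G.pareto _ hcard 2 3 fun o ho => ?_
      simp only [mixed, Multiset.mem_add, Multiset.mem_nsmul, Multiset.mem_singleton] at ho
      rcases ho with (⟨_, rfl⟩ | ho) | ho
      exacts [by decide, hu3 o ho, hv3 o ho]
    have z2 : G.F (mixed (l + 1) (u + {obcad}) v) 3 = 0 := by
      refine G.pareto _ hcard' 2 3 fun o ho => ?_
      simp only [mixed, Multiset.mem_add, Multiset.mem_nsmul, Multiset.mem_singleton] at ho
      rcases ho with (⟨_, rfl⟩ | ho | rfl) | ho
      exacts [by decide, hu3 o ho, by decide, hv3 o ho]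
    have s1 := G.sum_one _ hcard
    have s2 := G.sum_one _ hcard'
    have n1 := G.nonneg _ hcard
    have n2 := G.nonneg _ hcard'
    generalize G.F (mixed (l + 1 + 1) u v) = q at *
    generalize G.F (mixed (l + 1) (u + {obcad}) v) = r at *
    simp only [phi_oabcd, phi_obcad, bracket, z1, z2] at *
    have e1 : q 0 = 1 - q 1 - q 2 := by linarith
    have e2 : r 0 = 1 - r 1 - r 2 := by linarith
    refine le_of_wedge (x := q 1) (α := r 1) (β := r 2) (γ := r 0) (n1 1) (n1 2)
      (by linarith) (by linarith) (by linarith) ?_ ?_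
    · rw [e1, e2] at p1 ⊢; linarith
    · rw [e1, e2] at p2 ⊢; linarith

/-- An `ocabd` voter can complete a majority for 0; for c = 2 this holds after the other one has
switched to `oabcd`, and `le_of_wedge` undoes the switch. -/
lemma one_le_two (hn : 2 * K + c = n) (hc : c = 1 ∨ c = 2) {u : Multiset Ranking}
    (hu : u.card = K) (hu3 : ∀ o ∈ u, Above o 2 3) :
    G.F (mixed K u (c • {ocabd})) 1 ≤ G.F (mixed K u (c • {ocabd})) 2 := by
  have hcard : (mixed K u (c • {ocabd})).card = n := by rw [card_mixed]; simp; omega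
  rcases hc with rfl | rfl
  · have h := G.gap_ocabd (s := mixed K u (1 • {ocabd})) (s₁ := K • {oabcd}) (s₂ := u)
      (by simp only [mixed, one_smul]; abel)
      (fun o ho => by rw [Multiset.mem_singleton.1 (Multiset.mem_nsmul.1 ho).2]; rfl) hcard
      (by simp; omega)
    linarith [G.nonneg _ hcard 3]
  · have hcard' : (mixed (K + 1) u {ocabd}).card = n := by rw [card_mixed]; simp; omega
    have h := G.gap_ocabd (s := mixed (K + 1) u {ocabd}) (s₁ := (K + 1) • {oabcd}) (s₂ := u)
      (by simp only [mixed]; abel)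
      (fun o ho => by rw [Multiset.mem_singleton.1 (Multiset.mem_nsmul.1 ho).2]; rfl) hcard'
      (by simp; omega)
    have e1 : mixed K u (2 • {ocabd}) = {ocabd} + (K • {oabcd} + u + {ocabd}) := by
      simp only [mixed, two_smul]; abel
    have e2 : mixed (K + 1) u {ocabd} = {oabcd} + (K • {oabcd} + u + {ocabd}) := by
      simp only [mixed, add_smul, one_smul]; abel
    have p1 := G.sp' _ _ _ e1 e2 hcard
    have p2 := G.sp' _ _ _ e2 e1 hcard'
    have z1 : G.F (mixed K u (2 • {ocabd})) 3 = 0 := by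
      refine G.pareto _ hcard 2 3 fun o ho => ?_
      simp only [mixed, Multiset.mem_add, Multiset.mem_nsmul, Multiset.mem_singleton] at ho
      rcases ho with (⟨_, rfl⟩ | ho) | ⟨_, rfl⟩
      exacts [by decide, hu3 o ho, by decide]
    have z2 : G.F (mixed (K + 1) u {ocabd}) 3 = 0 := by
      refine G.pareto _ hcard' 2 3 fun o ho => ?_
      simp only [mixed, Multiset.mem_add, Multiset.mem_nsmul, Multiset.mem_singleton] at ho
      rcases ho with (⟨_, rfl⟩ | ho) | rfl
      exacts [by decide, hu3 o ho, by decide]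
    have s1 := G.sum_one _ hcard
    have s2 := G.sum_one _ hcard'
    have n1 := G.nonneg _ hcard
    have n2 := G.nonneg _ hcard'
    generalize G.F (mixed K u (2 • {ocabd})) = q at *
    generalize G.F (mixed (K + 1) u {ocabd}) = r at *
    simp only [phi_oabcd, phi_ocabd, bracket, z1, z2] at *
    have e1 : q 2 = 1 - q 0 - q 1 := by linarith
    have e2 : r 2 = 1 - r 0 - r 1 := by linarith
    refine le_of_wedge (x := q 0) (α := r 0) (β := r 1) (γ := r 2) (n1 0) (n1 1)
      (by linarith) (by linarith) (by linarith) ?_ ?_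
    · rw [e1, e2] at p1 ⊢; linarith
    · rw [e1, e2] at p2 ⊢; linarith

lemma one_le_three (hn : 2 * K + c = n) (hc : c = 1 ∨ c = 2) :
    G.F (mixed K (K • {obcda}) (c • {odabc})) 2 = 0 ∧
    G.F (mixed K (K • {obcda}) (c • {odabc})) 1 ≤ G.F (mixed K (K • {obcda}) (c • {odabc})) 3 := by
  have hcard : (mixed K (K • {obcda}) (c • {odabc})).card = n := by rw [card_mixed]; simp; omega
  have z1 : G.F (mixed K (K • {obcda}) (c • {odabc})) 2 = 0 := by
    refine G.pareto _ hcard 1 2 fun o ho => ?_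
    simp only [mixed, Multiset.mem_add, Multiset.mem_nsmul, Multiset.mem_singleton] at ho
    rcases ho with (⟨_, rfl⟩ | ⟨_, rfl⟩) | ⟨_, rfl⟩ <;> decide
  refine ⟨z1, ?_⟩
  rcases hc with rfl | rfl
  · have h := G.gap_odabc (s := mixed K (K • {obcda}) (1 • {odabc})) (s₁ := K • {oabcd})
      (s₂ := K • {obcda}) (by simp only [mixed, one_smul]; abel)
      (fun o ho => by rw [Multiset.mem_singleton.1 (Multiset.mem_nsmul.1 ho).2]; rfl) hcard
      (by simp)
    linarith [G.nonneg _ hcard 2]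
  · have hcard' : (mixed (K + 1) (K • {obcda}) {odabc}).card = n := by
      rw [card_mixed]; simp; omega
    have h := G.gap_odabc (s := mixed (K + 1) (K • {obcda}) {odabc}) (s₁ := (K + 1) • {oabcd})
      (s₂ := K • {obcda}) (by simp only [mixed]; abel)
      (fun o ho => by rw [Multiset.mem_singleton.1 (Multiset.mem_nsmul.1 ho).2]; rfl) hcard'
      (by simp)
    have e1 : mixed K (K • {obcda}) (2 • {odabc}) =
        {odabc} + (K • {oabcd} + K • {obcda} + {odabc}) := by
      simp only [mixed, two_smul]; abel
    have e2 : mixed (K + 1) (K • {obcda}) {odabc} =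
        {oabcd} + (K • {oabcd} + K • {obcda} + {odabc}) := by
      simp only [mixed, add_smul, one_smul]; abel
    have p1 := G.sp' _ _ _ e1 e2 hcard
    have p2 := G.sp' _ _ _ e2 e1 hcard'
    have z2 : G.F (mixed (K + 1) (K • {obcda}) {odabc}) 2 = 0 := by
      refine G.pareto _ hcard' 1 2 fun o ho => ?_
      simp only [mixed, Multiset.mem_add, Multiset.mem_nsmul, Multiset.mem_singleton] at ho
      rcases ho with (⟨_, rfl⟩ | ⟨_, rfl⟩) | rfl <;> decide
    have s1 := G.sum_one _ hcard
    have s2 := G.sum_one _ hcard'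
    have n1 := G.nonneg _ hcard
    have n2 := G.nonneg _ hcard'
    generalize G.F (mixed K (K • {obcda}) (2 • {odabc})) = q at *
    generalize G.F (mixed (K + 1) (K • {obcda}) {odabc}) = r at *
    simp only [phi_oabcd, phi_odabc, bracket, z1, z2] at *
    have e1 : q 3 = 1 - q 0 - q 1 := by linarith
    have e2 : r 3 = 1 - r 0 - r 1 := by linarith
    refine le_of_wedge (x := q 0) (α := r 0) (β := r 1) (γ := r 3) (n1 0) (n1 1)
      (by linarith) (by linarith) (by linarith) ?_ ?_
    · rw [e1, e2] at p1 ⊢; linarith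
    · rw [e1, e2] at p2 ⊢; linarith

/-- An `oabcd` voter can secure 1, which is second best, so without any chance of 0 the outcome must
be 1 itself. For c = 2 this applies after one voter switches to `obcda`. -/
lemma eq_zero_of_zero_eq_zero (hn : 2 * K + c = n) (hc : c = 1 ∨ c = 2) (hK : c ≤ K)
    {v : Multiset Ranking} (hv : v.card = c) (h0 : G.F (mixed K (K • {obcda}) v) 0 = 0) :
    G.F (mixed K (K • {obcda}) v) 2 = 0 ∧ G.F (mixed K (K • {obcda}) v) 3 = 0 := by
  obtain ⟨k, rfl⟩ : ∃ k, K = k + 1 := ⟨K - 1, by omega⟩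
  have hcard : (mixed (k + 1) ((k + 1) • {obcda}) v).card = n := by rw [card_mixed]; simp; omega
  have htop : ∀ m, ∀ o ∈ m • ({obcda} : Multiset Ranking), o 0 = 1 := fun m o ho => by
    rw [Multiset.mem_singleton.1 (Multiset.mem_nsmul.1 ho).2]; rfl
  rcases hc with rfl | rfl
  · have h := G.gap_oabcd (s := mixed (k + 1) ((k + 1) • {obcda}) v) (s₁ := (k + 1) • {obcda})
      (s₂ := k • {oabcd} + v)
      (by simp only [mixed, add_smul, one_smul]; abel) (htop _) hcard (by simp; omega)
    have := G.nonneg _ hcard 2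
    have := G.nonneg _ hcard 3
    constructor <;> linarith
  · obtain ⟨l, rfl⟩ : ∃ l, k = l + 1 := ⟨k - 1, by omega⟩
    have hcard' : (mixed (l + 1) ((l + 1 + 1 + 1) • {obcda}) v).card = n := by
      rw [card_mixed]; simp; omega
    have h := G.gap_oabcd (s := mixed (l + 1) ((l + 1 + 1 + 1) • {obcda}) v)
      (s₁ := (l + 1 + 1 + 1) • {obcda})
      (s₂ := l • {oabcd} + v) (by simp only [mixed, add_smul, one_smul]; abel)
      (htop _) hcard' (by simp; omega)
    have e1 : mixed (l + 1 + 1) ((l + 1 + 1) • {obcda}) v =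
        {oabcd} + ((l + 1) • {oabcd} + (l + 1 + 1) • {obcda} + v) := by
      simp only [mixed, add_smul, one_smul]; abel
    have e2 : mixed (l + 1) ((l + 1 + 1 + 1) • {obcda}) v =
        {obcda} + ((l + 1) • {oabcd} + (l + 1 + 1) • {obcda} + v) := by
      simp only [mixed, add_smul, one_smul]; abel
    have p1 := G.sp' _ _ _ e1 e2 hcard
    have p2 := G.sp' _ _ _ e2 e1 hcard'
    have s1 := G.sum_one _ hcard
    have s2 := G.sum_one _ hcard'
    have n1 := G.nonneg _ hcard
    have n2 := G.nonneg _ hcard'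
    generalize G.F (mixed (l + 1 + 1) ((l + 1 + 1) • {obcda}) v) = q at *
    generalize G.F (mixed (l + 1) ((l + 1 + 1 + 1) • {obcda}) v) = r at *
    simp only [phi_oabcd, phi_obcda, bracket, h0] at p1 p2
    have e1 : q 1 = 1 - q 2 - q 3 := by linarith
    -- The two rankings disagree only in where 0 stands; adding `p1` and `p2` leaves -2 * r 0 * (q 1
    -- + q 2 + q 3) ≥ 0.
    have hr0 : r 0 = 0 := by
      have e2 : r 0 * (q 1 + q 2 + q 3) = r 0 := by rw [e1]; ring
      have := n2 0
      linarith
    have hr2 : r 2 = 0 := by linarith [n2 2, n2 3]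
    have hr3 : r 3 = 0 := by linarith [n2 2, n2 3]
    have hr1 : r 1 = 1 := by linarith
    simp only [hr0, hr1, hr2, hr3] at p1
    have := n1 2
    have := n1 3
    constructor <;> linarith

end Rule

/-! ### The Condorcet cycle on 0, 1, 2 -/

namespace Rule

variable {n : ℕ} (G : Rule n) {K c : ℕ}

lemma mixed_three {k : ℕ} {u v : Multiset Ranking} (hc : (mixed k u v).card = n)
    (hu : ∀ o ∈ u, Above o 2 3) (hv : ∀ o ∈ v, Above o 2 3) : G.F (mixed k u v) 3 = 0 := by
  refine G.pareto _ hc 2 3 fun o ho => ?_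
  simp only [mixed, Multiset.mem_add, Multiset.mem_nsmul, Multiset.mem_singleton] at ho
  rcases ho with (⟨_, rfl⟩ | ho) | ho
  exacts [by decide, hu o ho, hv o ho]

/-- A profile on the cyclic orders `0 1 2`, `1 2 0` and `2 0 1`, with `3` dominated by `2`. -/
def cyc (K i j l : ℕ) : Multiset Ranking :=
  mixed K (i • {obcad} + j • {obcda}) (l • {ocabd})

lemma card_cyc (K i j l : ℕ) : (cyc K i j l).card = K + i + j + l := by
  simp [cyc, card_mixed, add_assoc]

lemma cyc_three {i j l : ℕ} (hc : (cyc K i j l).card = n) : G.F (cyc K i j l) 3 = 0 := by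
  refine G.mixed_three hc (fun o ho => ?_) (fun o ho => ?_)
  · simp only [Multiset.mem_add, Multiset.mem_nsmul, Multiset.mem_singleton] at ho
    rcases ho with ⟨_, rfl⟩ | ⟨_, rfl⟩ <;> decide
  · rw [Multiset.mem_singleton.1 (Multiset.mem_nsmul.1 ho).2]; decide

lemma cyc_order {i j : ℕ} (hn : 2 * K + c = n) (hc : c = 1 ∨ c = 2) (hK : c ≤ K) (hij : i + j = K) :
    G.F (cyc K i j c) 1 ≤ G.F (cyc K i j c) 2 ∧ G.F (cyc K i j c) 2 ≤ G.F (cyc K i j c) 0 := by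
  have h3 : ∀ o ∈ (i • {obcad} + j • {obcda} : Multiset Ranking), Above o 2 3 := by
    intro o ho
    simp only [Multiset.mem_add, Multiset.mem_nsmul, Multiset.mem_singleton] at ho
    rcases ho with ⟨_, rfl⟩ | ⟨_, rfl⟩ <;> decide
  refine ⟨G.one_le_two hn hc (by simp [hij]) h3, G.two_le_zero hn hc hK (by simp [hij]) (by simp)
    (fun o ho => ?_) h3 (fun o ho => ?_)⟩
  · simp only [Multiset.mem_add, Multiset.mem_nsmul, Multiset.mem_singleton] at ho
    rcases ho with ⟨_, rfl⟩ | ⟨_, rfl⟩ <;> rfl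
  · rw [Multiset.mem_singleton.1 (Multiset.mem_nsmul.1 ho).2]; decide

/-- The permutation `0 → 2 → 1 → 0`. -/
def rot : Ranking := ⟨![2, 0, 1, 3], ![1, 2, 0, 3], by decide, by decide⟩

lemma rot_oabcd : rot * oabcd = ocabd := by decide
lemma rot_obcad : rot * obcad = oabcd := by decide
lemma rot_ocabd : rot * ocabd = obcad := by decide

lemma cyc_rot (hn : 2 * K + c = n) (x : Fin 4) :
    G.F (cyc K c 0 K) (rot x) = G.F (cyc K K 0 c) x := by
  rw [← G.neutral (cyc K K 0 c) (by rw [card_cyc]; omega) rot x]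
  congr 1
  simp only [cyc, mixed, Multiset.map_add, Multiset.map_nsmul, Multiset.map_singleton, rot_oabcd,
    rot_obcad, rot_ocabd, zero_smul, Multiset.map_zero]
  abel_nf

/-- The voter moves 1 from first to third place among 0, 1, 2. The terms comparing 1 with the others
agree in both strategyproofness conditions, while the term comparing 2 with 0 changes sign, whence
the absolute value. -/
lemma cyc_step {i l : ℕ} (h : K + i + 1 + l = n) :
    |G.F (cyc K (i + 1) 0 l) 2 * G.F (cyc K i 0 (l + 1)) 0 -
      G.F (cyc K i 0 (l + 1)) 2 * G.F (cyc K (i + 1) 0 l) 0| ≤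
      G.F (cyc K (i + 1) 0 l) 1 - G.F (cyc K i 0 (l + 1)) 1 := by
  have e1 : cyc K (i + 1) 0 l = {obcad} + cyc K i 0 l := by
    simp only [cyc, mixed, add_smul, one_smul]; abel
  have e2 : cyc K i 0 (l + 1) = {ocabd} + cyc K i 0 l := by
    simp only [cyc, mixed, add_smul, one_smul]; abel
  have c1 : (cyc K (i + 1) 0 l).card = n := by rw [card_cyc]; omega
  have c2 : (cyc K i 0 (l + 1)).card = n := by rw [card_cyc]; omega
  have p1 := G.sp' _ _ _ e1 e2 c1
  have p2 := G.sp' _ _ _ e2 e1 c2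
  have s1 := G.sum_one _ c1
  have s2 := G.sum_one _ c2
  simp only [phi_obcad, phi_ocabd, bracket, G.cyc_three c1, G.cyc_three c2] at *
  generalize G.F (cyc K (i + 1) 0 l) = q at *
  generalize G.F (cyc K i 0 (l + 1)) = r at *
  have e1 : q 1 - r 1 = q 1 * (r 0 + r 2) - r 1 * (q 0 + q 2) := by
    linear_combination r 1 * s1 - q 1 * s2
  rw [e1, abs_le]
  constructor <;> linarith

/-- Turning `obcad` into `ocabd` never raises the probability of 1 and ends at a rotation of the
initial profile, where 1 has the role of 2. With `cyc_order` this gives equal probabilities for 1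
and 2, so every step is tight; then the probability of 0 is constant too, and the rotation
identifies it with that of 1. -/
lemma cyc_zero_one_two (hn : 2 * K + c = n) (hc : c = 1 ∨ c = 2) (hK : c ≤ K) :
    G.F (cyc K K 0 c) 0 = 1 / 3 ∧ G.F (cyc K K 0 c) 1 = 1 / 3 ∧ G.F (cyc K K 0 c) 2 = 1 / 3 := by
  have hcard : (cyc K K 0 c).card = n := by rw [card_cyc]; omega
  obtain ⟨h12, h20⟩ := G.cyc_order hn hc hK (add_zero K)
  have hs := G.sum_one _ hcard
  rw [G.cyc_three hcard] at hs
  have hn2 := G.nonneg _ hcard 2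
  have key : ∀ j i, i + j = K → G.F (cyc K i 0 (c + j)) 1 ≤ G.F (cyc K K 0 c) 1 ∧
      (G.F (cyc K i 0 (c + j)) 1 = G.F (cyc K K 0 c) 1 →
        G.F (cyc K i 0 (c + j)) 0 = G.F (cyc K K 0 c) 0) := by
    intro j
    induction j with
    | zero => rintro i rfl; exact ⟨le_rfl, fun _ => rfl⟩
    | succ j ih =>
      intro i hi
      obtain ⟨ih1, ih2⟩ := ih (i + 1) (by omega)
      have hstep := G.cyc_step (K := K) (i := i) (l := c + j) (by omega)
      have c1 : (cyc K (i + 1) 0 (c + j)).card = n := by rw [card_cyc]; omega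
      have c2 : (cyc K i 0 (c + (j + 1))).card = n := by rw [card_cyc]; omega
      have s1 := G.sum_one _ c1
      have s2 := G.sum_one _ c2
      rw [G.cyc_three c1] at s1
      rw [G.cyc_three c2] at s2
      rw [← add_assoc] at s2 ⊢
      have habs := (abs_nonneg _).trans hstep
      refine ⟨by linarith, fun heq => ?_⟩
      have h1 : G.F (cyc K (i + 1) 0 (c + j)) 1 = G.F (cyc K K 0 c) 1 := by linarith
      rw [← ih2 h1]
      have hz := abs_nonpos_iff.1 (hstep.trans (by linarith))
      generalize G.F (cyc K (i + 1) 0 (c + j)) = q at *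
      generalize G.F (cyc K i 0 (c + j + 1)) = r at *
      have e1 : q 2 = 1 - q 1 - q 0 := by linarith
      have e2 : r 2 = 1 - q 1 - r 0 := by linarith
      rw [e1, e2] at hz
      have : (1 - q 1) * (r 0 - q 0) = 0 := by linear_combination hz
      rcases mul_eq_zero.1 this with h | h <;> linarith
  obtain ⟨k1, k2⟩ := key (K - c) c (by omega)
  rw [Nat.add_sub_cancel' hK] at k1 k2
  have r1 : G.F (cyc K c 0 K) 1 = G.F (cyc K K 0 c) 2 := G.cyc_rot hn 2
  have r0 : G.F (cyc K c 0 K) 0 = G.F (cyc K K 0 c) 1 := G.cyc_rot hn 1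
  have := k2 (by linarith)
  refine ⟨?_, ?_, ?_⟩ <;> linarith

/-- The rule randomizes uniformly over the cycle `0`, `1`, `2`. -/
lemma cyc_uniform (hn : 2 * K + c = n) (hc : c = 1 ∨ c = 2) (hK : c ≤ K) : ∀ j i, i + j = K →
    G.F (cyc K i j c) 0 = 1 / 3 ∧ G.F (cyc K i j c) 1 = 1 / 3 ∧ G.F (cyc K i j c) 2 = 1 / 3 := by
  intro j
  induction j with
  | zero => rintro i rfl; exact G.cyc_zero_one_two hn hc hK
  | succ j ih =>
    intro i hi
    obtain ⟨i0, i1, i2⟩ := ih (i + 1) (by omega)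
    have e1 : cyc K (i + 1) j c = {obcad} + cyc K i j c := by
      simp only [cyc, mixed, add_smul, one_smul]; abel
    have e2 : cyc K i (j + 1) c = {obcda} + cyc K i j c := by
      simp only [cyc, mixed, add_smul, one_smul]; abel
    have c1 : (cyc K (i + 1) j c).card = n := by rw [card_cyc]; omega
    have c2 : (cyc K i (j + 1) c).card = n := by rw [card_cyc]; omega
    have p1 := G.sp' _ _ _ e1 e2 c1
    have p2 := G.sp' _ _ _ e2 e1 c2
    have s2 := G.sum_one _ c2
    -- Both rankings agree on 0, 1, 2, so the voter is indifferent. Against the uniform lottery this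
    -- means that 0 and 1 have equal probability, and the order from `cyc_order` does the rest.
    obtain ⟨h12, h20⟩ := G.cyc_order hn hc hK hi
    rw [G.cyc_three c2] at s2
    simp only [phi_obcad, phi_obcda, bracket, G.cyc_three c1, G.cyc_three c2, i0, i1, i2] at p1 p2
    refine ⟨?_, ?_, ?_⟩ <;> linarith

/-! ### Raising 3 on the last c ballots, and the contradiction -/

/-- If `0` and `3` both have positive probability, then shifting probability to `2` is an
improvement for everybody. -/
lemma base_three_or_zero (hn : 2 * K + c = n) {v : Multiset Ranking} (hv : v.card = c)
    (hv' : ∀ o ∈ v, o = ocabd ∨ o = odcab) (hv3 : odcab ∈ v) (hK : 0 < K) :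
    G.F (mixed K (K • {obcda}) v) 3 = 0 ∨ G.F (mixed K (K • {obcda}) v) 0 = 0 := by
  have hcard : (mixed K (K • {obcda}) v).card = n := by rw [card_mixed]; simp; omega
  by_contra hcon
  push Not at hcon
  have n3 := lt_of_le_of_ne (G.nonneg _ hcard 3) hcon.1.symm
  have n0 := lt_of_le_of_ne (G.nonneg _ hcard 0) hcon.2.symm
  have n1 := G.nonneg _ hcard 1
  have n2 := G.nonneg _ hcard 2
  have hs := G.sum_one _ hcard
  have heff := G.eff _ hcard
  have hmem : ∀ o ∈ mixed K (K • {obcda}) v, o = oabcd ∨ o = obcda ∨ o = ocabd ∨ o = odcab := by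
    intro o ho
    simp only [mixed, Multiset.mem_add, Multiset.mem_nsmul, Multiset.mem_singleton] at ho
    rcases ho with (⟨_, rfl⟩ | ⟨_, rfl⟩) | ho
    · simp
    · simp
    · rcases hv' o ho with rfl | rfl <;> simp
  have hB : obcda ∈ mixed K (K • {obcda}) v := by simp [mixed, Multiset.mem_nsmul, hK.ne']
  have hD : odcab ∈ mixed K (K • {obcda}) v := by simp [mixed, hv3]
  generalize G.F (mixed K (K • {obcda}) v) = q at *
  set a := q 0
  set b := q 1
  set z := q 2
  set d := q 3
  rcases n1.lt_or_eq with hb | hb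
  -- Mass moves from 1 and 3 to 2 in the ratio z + d to b + z, which makes voters with 1 over 2 over
  -- 3 and 0 at either end indifferent. The gain of `odcab` is strict because a > 0.
  · have hp := heff ![a, b - b * d * (z + d), z + b * d * (b + z + (z + d)), d - b * d * (b + z)]
      (by
        intro i
        fin_cases i <;> simp only [Fin.zero_eta, Fin.mk_one, Fin.reduceFinMk, Matrix.cons_val]
        · exact n0.le
        · have : b - b * d * (z + d) = b * ((1 - d) + d * (1 - (z + d))) := by ring
          rw [this]
          exact mul_nonneg n1 (add_nonneg (by linarith) (mul_nonneg n3.le (by linarith)))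
        · positivity
        · have : d - b * d * (b + z) = d * ((1 - b) + b * (1 - (b + z))) := by ring
          rw [this]
          exact mul_nonneg n3.le (add_nonneg (by linarith) (mul_nonneg n1 (by linarith))))
      (by simp only [Matrix.cons_val]; linear_combination hs)
    have hD' : 0 < phi odcab
        ![a, b - b * d * (z + d), z + b * d * (b + z + (z + d)), d - b * d * (b + z)] q := by
      refine lt_of_lt_of_eq (show 0 < b * d * ((z + d) * (2 * a)) by positivity) ?_
      simp only [phi_odcab, bracket, Matrix.cons_val]
      ring
    refine absurd (hp ?_ _ hD) (not_le.2 hD')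
    intro o ho
    rcases hmem o ho with rfl | rfl | rfl | rfl
    · refine le_of_eq ?_
      simp only [phi_oabcd, bracket, Matrix.cons_val]
      ring
    · refine le_of_eq ?_
      simp only [phi_obcda, bracket, Matrix.cons_val]
      ring
    · refine le_of_le_of_eq (show 0 ≤ b * d *
        ((b + z) * (2 * a + 2 * b + z + d) + (z + d) * (2 * a + b + z)) by positivity) ?_
      simp only [phi_ocabd, bracket, Matrix.cons_val]
      ring
    · exact hD'.le
  · have hb' : q 1 = 0 := hb.symm
    -- With 1 absent, the same shift is made from 0 and 3 to 2. Now `oabcd` and its reversal on 0,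
    -- 2, 3 are indifferent, and `obcda` gains strictly.
    have hp := heff ![a - a * d * (z + d), 0, z + a * d * (a + z + (z + d)), d - a * d * (a + z)]
      (by
        intro i
        fin_cases i <;> simp only [Fin.zero_eta, Fin.mk_one, Fin.reduceFinMk, Matrix.cons_val]
        · have : a - a * d * (z + d) = a * ((1 - d) + d * (1 - (z + d))) := by ring
          rw [this]
          exact mul_nonneg n0.le (add_nonneg (by linarith) (mul_nonneg n3.le (by linarith)))
        · exact le_rfl
        · positivity
        · have : d - a * d * (a + z) = d * ((1 - a) + a * (1 - (a + z))) := by ring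
          rw [this]
          exact mul_nonneg n3.le (add_nonneg (by linarith) (mul_nonneg n0.le (by linarith))))
      (by simp only [Matrix.cons_val]; linear_combination hs + hb)
    have hB' : 0 < phi obcda
        ![a - a * d * (z + d), 0, z + a * d * (a + z + (z + d)), d - a * d * (a + z)] q := by
      refine lt_of_lt_of_eq (show 0 < a * d * ((a + z) * (z + d) + (z + d) * (a + z + 2 * d)) by
        positivity) ?_
      simp only [phi_obcda, bracket, Matrix.cons_val, hb']
      ring
    refine absurd (hp ?_ _ hB) (not_le.2 hB')
    intro o ho
    rcases hmem o ho with rfl | rfl | rfl | rfl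
    · refine le_of_eq ?_
      simp only [phi_oabcd, bracket, Matrix.cons_val, hb']
      ring
    · exact hB'.le
    · refine le_of_le_of_eq
        (show 0 ≤ a * d * ((a + z) * (2 * a + z + d) + (z + d) * (a + z)) by positivity) ?_
      simp only [phi_ocabd, bracket, Matrix.cons_val, hb']
      ring
    · refine le_of_eq ?_
      simp only [phi_odcab, bracket, Matrix.cons_val, hb']
      ring

/-- The profile where `K` voters report `oabcd`, `K` voters report `obcda`, and the others report
`v`. -/
def base (K : ℕ) (v : Multiset Ranking) : Multiset Ranking := mixed K (K • {obcda}) v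

lemma card_base (hn : 2 * K + c = n) {v : Multiset Ranking} (hv : v.card = c) :
    (base K v).card = n := by
  rw [base, card_mixed]; simp; omega

/-- The `obcda` voters rank 0 last, so a sure 0 would persist when they report `odabc`; but then K +
c voters form a majority for 3. -/
lemma base_zero_ne_one (hn : 2 * K + c = n) (hc : 0 < c) {v : Multiset Ranking} (hv : v.card = c)
    (hv' : ∀ o ∈ v, o 0 = 3) : G.F (base K v) 0 ≠ 1 := by
  intro h
  have h1 := G.stable_bottoms (x := 0) (o := obcda) rfl (K • {odabc}) (K • {oabcd} + v)
    (by simp; omega) (by rw [← h]; simp only [base, mixed, Multiset.card_nsmul,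
      Multiset.card_singleton, mul_one]; congr 1; abel)
  have h2 := G.majority (x := 3) (s₁ := K • {odabc} + v) (s₂ := K • {oabcd})
    (fun o ho => by
      rcases Multiset.mem_add.1 ho with ho | ho
      · rw [Multiset.mem_singleton.1 (Multiset.mem_nsmul.1 ho).2]; rfl
      · exact hv' o ho) (by simp; omega) (by simp; omega)
  rw [show (K • {odabc} + v + K • {oabcd} : Multiset Ranking) = K • {odabc} + (K • {oabcd} + v) by
    abel] at h2
  have hcard : (K • {odabc} + (K • {oabcd} + v) : Multiset Ranking).card = n := by simp; omega
  have := G.sum_one _ hcard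
  linarith [G.nonneg _ hcard 1, G.nonneg _ hcard 2]

lemma base_three (hn : 2 * K + c = n) (hc : c = 1 ∨ c = 2) (hK : c ≤ K) {v : Multiset Ranking}
    (hv : v.card = c) (hv' : ∀ o ∈ v, o = ocabd ∨ o = odcab) (hv3 : odcab ∈ v) :
    G.F (base K v) 3 = 0 := by
  rcases G.base_three_or_zero hn hv hv' hv3 (by omega) with h | h
  · exact h
  · exact (G.eq_zero_of_zero_eq_zero hn hc hK hv h).2

/-- The rankings `ocabd` and `odcab` agree on 0, 1, 2. As 3 has probability 0 in both outcomes, the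
voter is indifferent, and this transfers the equality. -/
lemma base_step (hn : 2 * K + c = n) {t : Multiset Ranking} (ht : t.card + 1 = c)
    (h3 : G.F (base K ({ocabd} + t)) 3 = 0) (h3' : G.F (base K ({odcab} + t)) 3 = 0)
    (h12 : G.F (base K ({ocabd} + t)) 1 = G.F (base K ({ocabd} + t)) 2) :
    G.F (base K ({odcab} + t)) 1 = G.F (base K ({odcab} + t)) 2 := by
  have c1 : (base K ({ocabd} + t)).card = n := card_base hn (by simp; omega)
  have c2 : (base K ({odcab} + t)).card = n := card_base hn (by simp; omega)
  have p1 := G.sp' (s := base K ({ocabd} + t)) (s' := base K ({odcab} + t)) ocabd odcab (base K t)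
    (by simp only [base, mixed]; abel) (by simp only [base, mixed]; abel) c1
  have p2 := G.sp' (s := base K ({odcab} + t)) (s' := base K ({ocabd} + t)) odcab ocabd (base K t)
    (by simp only [base, mixed]; abel) (by simp only [base, mixed]; abel) c2
  have s1 := G.sum_one _ c1
  have n1 := G.nonneg _ c1
  generalize G.F (base K ({ocabd} + t)) = q at *
  generalize G.F (base K ({odcab} + t)) = r at *
  simp only [phi_ocabd, phi_odcab, bracket, h3, h3', h12] at p1 p2 s1
  have h : (q 0 + q 2) * (r 1 - r 2) = 0 := by linarith
  rcases mul_eq_zero.1 h with h | h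
  · linarith [n1 0, n1 2]
  · linarith

lemma base_odcab (hn : 2 * K + c = n) (hc : c = 1 ∨ c = 2) (hK : c ≤ K) :
    G.F (base K (c • {odcab})) 3 = 0 ∧
    G.F (base K (c • {odcab})) 1 = G.F (base K (c • {odcab})) 2 := by
  have e : base K (c • {ocabd}) = cyc K 0 K c := by simp [base, cyc]
  have h3 : G.F (base K (c • {ocabd})) 3 = 0 := by
    rw [e, G.cyc_three (by rw [card_cyc]; omega)]
  have h12 : G.F (base K (c • {ocabd})) 1 = G.F (base K (c • {ocabd})) 2 := by
    obtain ⟨_, h1, h2⟩ := G.cyc_uniform hn hc hK K 0 (zero_add K)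
    rw [e, h1, h2]
  have h3' : G.F (base K (c • {odcab})) 3 = 0 := by
    refine G.base_three hn hc hK (by simp) (fun o ho => ?_) ?_
    · exact Or.inr (Multiset.mem_singleton.1 (Multiset.mem_nsmul.1 ho).2)
    · rw [Multiset.mem_nsmul]; exact ⟨by omega, by simp⟩
  refine ⟨h3', ?_⟩
  rcases hc with rfl | rfl
  · simp only [one_smul] at *
    exact G.base_step (t := 0) hn (by simp) h3 h3' h12
  · simp only [two_smul] at *
    have h3'' : G.F (base K ({odcab} + {ocabd})) 3 = 0 := by
      refine G.base_three hn (by simp) hK (by simp) (fun o ho => ?_) (by simp)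
      simp only [Multiset.mem_add, Multiset.mem_singleton] at ho
      tauto
    have h := G.base_step hn (by simp) h3 h3'' h12
    rw [add_comm] at h h3''
    exact G.base_step hn (by simp) h3'' h3' h

/-- The lotteries selected when the last `c` voters report `odcab` or `odabc` are incompatible. -/
theorem false_of_le (G : Rule n) (hn : 2 * K + c = n) (hc : c = 1 ∨ c = 2) (hK : c ≤ K) : False := by
  obtain ⟨q3, q12⟩ := G.base_odcab hn hc hK
  obtain ⟨p2, p13⟩ := G.one_le_three hn hc
  change G.F (base K _) 2 = 0 at p2
  change G.F (base K _) 1 ≤ G.F (base K _) 3 at p13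
  have htop : ∀ v : Multiset Ranking, (∀ o ∈ v, o = odabc ∨ o = odcab) → ∀ o ∈ v, o 0 = 3 := by
    intro v hv o ho
    rcases hv o ho with rfl | rfl <;> rfl
  have hq := G.base_zero_ne_one hn (by omega) (v := c • {odcab}) (by simp) (htop _ fun o ho =>
    Or.inr (Multiset.mem_singleton.1 (Multiset.mem_nsmul.1 ho).2))
  have hp := G.base_zero_ne_one hn (by omega) (v := c • {odabc}) (by simp) (htop _ fun o ho =>
    Or.inl (Multiset.mem_singleton.1 (Multiset.mem_nsmul.1 ho).2))
  have cq : (base K (c • {odcab})).card = n := card_base hn (by simp)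
  have cp : (base K (c • {odabc})).card = n := card_base hn (by simp)
  have sq := G.sum_one _ cq
  have sp := G.sum_one _ cp
  have nq := G.nonneg _ cq
  have np := G.nonneg _ cp
  rw [q3, q12] at sq
  rw [p2] at sp
  have hw : 0 < G.F (base K (c • {odcab})) 2 :=
    lt_of_le_of_ne (nq 2) fun h => hq (by linarith)
  have hz : 0 < G.F (base K (c • {odabc})) 3 :=
    lt_of_le_of_ne (np 3) fun h => hp (by linarith [np 1])
  rcases hc with rfl | rfl
  -- Truthfulness of `odcab` reads p 3 ≤ p 1 * (1 - q 2), against p 1 ≤ p 3 with p 3 and q 2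
  -- positive.
  · have h := G.sp' (s := base K (1 • {odcab})) (s' := base K (1 • {odabc})) odcab odabc
      (base K 0) (by simp only [base, mixed, one_smul]; abel)
      (by simp only [base, mixed, one_smul]; abel) cq
    generalize G.F (base K (1 • {odcab})) = q at *
    generalize G.F (base K (1 • {odabc})) = p at *
    simp only [phi_odcab, bracket, q3, q12, p2] at h
    have e : q 0 = 1 - 2 * q 2 := by linarith
    rw [e] at h
    have h1 : 0 ≤ p 1 - p 3 - p 1 * q 2 := by linarith
    have h2 : 0 ≤ p 1 * q 2 := mul_nonneg (np 1) hw.le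
    have h3 : p 1 = p 3 := by linarith
    have h4 : 0 < p 1 * q 2 := mul_pos (by linarith) hw
    linarith
  -- With two switching voters, the outcome t of the mixed profile is squeezed from both sides until
  -- t 1, t 2 and t 3 vanish, so 0 would be certain.
  · have ht' := G.base_zero_ne_one hn (by omega) (v := {odabc} + {odcab}) (by simp)
      (htop _ fun o ho => by simpa using ho)
    have ct : (base K ({odabc} + {odcab})).card = n := card_base hn (by simp)
    have st := G.sum_one _ ct
    have nt := G.nonneg _ ct
    have h := G.sp' (s := base K (2 • {odcab})) (s' := base K ({odabc} + {odcab})) odcab odabc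
      (base K {odcab}) (by simp only [base, mixed, two_smul]; abel)
      (by simp only [base, mixed]; abel) cq
    have h' := G.sp' (s := base K ({odabc} + {odcab})) (s' := base K (2 • {odabc})) odcab odabc
      (base K {odabc}) (by simp only [base, mixed]; abel)
      (by simp only [base, mixed, two_smul]; abel) ct
    generalize G.F (base K (2 • {odcab})) = q at *
    generalize G.F (base K (2 • {odabc})) = p at *
    generalize G.F (base K ({odabc} + {odcab})) = t at *
    simp only [phi_odcab, bracket, q3, q12, p2] at h h'
    have eq0 : q 0 = 1 - 2 * q 2 := by linarith
    have ep : p 0 = 1 - p 1 - p 3 := by linarith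
    have et : t 0 = 1 - t 1 - t 2 - t 3 := by linarith
    rw [eq0, et] at h
    have h1 : t 3 ≤ (1 - q 2) * (t 1 - t 2) := by linarith
    have h2 : (p 3 - p 1) * t 0 + (1 - p 1) * t 1 ≤ (1 - 2 * p 3) * t 2 + (1 - p 3) * t 3 := by
      rw [et]; rw [ep, et] at h'; linarith
    have h3 : 0 ≤ (p 3 - p 1) * (t 0 + t 1) :=
      mul_nonneg (by linarith) (add_nonneg (nt 0) (nt 1))
    have hp3 : 0 ≤ 1 - p 3 := by linarith [np 0, np 1]
    have h4 : (1 - p 3) * t 3 ≤ (1 - p 3) * ((1 - q 2) * (t 1 - t 2)) :=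
      mul_le_mul_of_nonneg_left h1 hp3
    have hq2 : 0 < 1 - q 2 := by linarith [nq 0]
    have h12 : 0 ≤ t 1 - t 2 := by
      by_contra hlt
      have := mul_neg_of_pos_of_neg hq2 (not_le.1 hlt)
      linarith [nt 3]
    have h5 : p 3 * t 2 + (1 - p 3) * (q 2 * (t 1 - t 2)) ≤ 0 := by linarith
    have h6 : 0 ≤ (1 - p 3) * (q 2 * (t 1 - t 2)) := mul_nonneg hp3 (mul_nonneg hw.le h12)
    have h7 : 0 ≤ p 3 * t 2 := mul_nonneg hz.le (nt 2)
    have t2 : t 2 = 0 := by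
      rcases mul_eq_zero.1 (show p 3 * t 2 = 0 by linarith) with h | h <;> linarith
    have h8 : (1 - p 3) * (q 2 * (t 1 - t 2)) = 0 := by linarith
    have t1 : t 1 = 0 := by
      rcases mul_eq_zero.1 h8 with h9 | h9
      · have e3 : p 3 = 1 := by linarith
        have e1 : p 1 = 0 := by linarith [np 0, np 1]
        rw [e3, e1, t2] at h2
        linarith [nt 0, nt 1]
      · rcases mul_eq_zero.1 h9 with h | h <;> linarith
    rw [t1, t2] at h1
    exact ht' (by linarith [nt 3])

end Rule

/-- There is no such rule for three voters, or for five or more voters. -/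
theorem not_rule {n : ℕ} (h3 : 3 ≤ n) (h4 : n ≠ 4) (G : Rule n) : False := by
  rcases Nat.even_or_odd' n with ⟨k, rfl | rfl⟩
  -- For n = 4 this choice would give K = 1 < c.
  · exact G.false_of_le (K := k - 1) (c := 2) (by omega) (Or.inr rfl) (by omega)
  · exact G.false_of_le (K := k) (c := 1) (by omega) (Or.inl rfl) (by omega)

/-! ### Profiles up to permutation of the voters, as multisets -/

section Multisets

variable {V R : Type*} [Fintype V]

lemma exists_perm_of_map_univ_eq {f g : V → R}
    (h : Finset.univ.val.map f = Finset.univ.val.map g) : ∃ σ : Equiv.Perm V, ∀ v, g (σ v) = f v := by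
  classical
  have e : ∀ c, {v // f v = c} ≃ {v // g v = c} := fun c => by
    refine Fintype.equivOfCardEq ?_
    have hc := congrArg (Multiset.count c) h
    simp only [Multiset.count_map] at hc
    rw [Fintype.card_subtype, Fintype.card_subtype]
    simp only [Finset.card, Finset.filter_val]
    simpa only [eq_comm] using hc
  exact ⟨Equiv.ofFiberEquiv e, fun v => Equiv.ofFiberEquiv_map e v⟩

lemma exists_map_univ_eq {s : Multiset R} (hs : s.card = Fintype.card V) :
    ∃ f : V → R, Finset.univ.val.map f = s := by
  induction s using Quotient.inductionOn with
  | h l =>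
    have e : V ≃ Fin l.length := Fintype.equivFinOfCardEq (by simpa using hs.symm)
    refine ⟨l.get ∘ e, ?_⟩
    rw [← Multiset.map_map, Multiset.map_univ_val_equiv, Fin.univ_val_map, List.ofFn_get]
    rfl

lemma map_univ_update [DecidableEq V] {f : V → R} {v : V} {t : Multiset R}
    (h : Finset.univ.val.map f = {f v} + t) (a : R) :
    Finset.univ.val.map (Function.update f v a) = {a} + t := by
  have hu : (Finset.univ : Finset V).val = v ::ₘ (Finset.univ.erase v).val := by
    rw [Finset.erase_val, Multiset.cons_erase (Finset.mem_univ v)]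
  rw [hu, Multiset.map_cons] at h ⊢
  rw [Multiset.singleton_add, Multiset.cons_inj_right] at h
  rw [Function.update_self, Multiset.singleton_add, ← h]
  congr 1
  refine Multiset.map_congr rfl fun w hw => ?_
  exact Function.update_of_ne (Finset.ne_of_mem_erase hw) _ _

end Multisets

/-! ### Pareto-dominated alternatives get probability 0 -/

section Score

variable {A : Type*} [Fintype A]

open Classical in
/-- The net probability that `x` beats an alternative drawn from `q`. -/
noncomputable def score (r : PrefRel A) (q : A → ℝ) (x : A) : ℝ :=
  ∑ y, ((if r.prefers x y then q y else 0) - if r.prefers y x then q y else 0)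

lemma winProb_sub (r : PrefRel A) (p q : Lottery A) :
    winProb r p q - winProb r q p = ∑ x, p.1 x * score r q.1 x := by
  classical
  have h : winProb r q p = ∑ x, ∑ y, if r.prefers y x then q.1 y * p.1 x else 0 := Finset.sum_comm
  rw [h, winProb, ← Finset.sum_sub_distrib]
  refine Finset.sum_congr rfl fun x _ => ?_
  rw [score, Finset.mul_sum, ← Finset.sum_sub_distrib]
  refine Finset.sum_congr rfl fun y _ => ?_
  split_ifs <;> ring

lemma score_lt {r : PrefRel A} {q : A → ℝ} (hq : ∀ x, 0 ≤ q x) {x y : A} (h : r.prefers x y)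
    (hy : 0 < q y) : score r q y < score r q x := by
  classical
  refine Finset.sum_lt_sum (fun z _ => ?_) ⟨y, Finset.mem_univ y, ?_⟩
  · have h1 : r.prefers y z → r.prefers x z := r.trans _ _ _ h
    have h2 : r.prefers z x → r.prefers z y := fun h' => r.trans _ _ _ h' h
    have := hq z
    split_ifs <;> first | linarith | tauto
  · have h1 : ¬ r.prefers y x := fun h' => r.irrefl _ (r.trans _ _ _ h h')
    simp only [r.irrefl y, h, h1, if_true, if_false]
    linarith

/-- An efficient scheme gives probability `0` to Pareto-dominated alternatives. -/
lemma SDS.PCEfficientOn.eq_zero {f : SDS A} {N : Electorate} (hf : f.PCEfficientOn N)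
    {R : Profile A N} {x y : A} (h : ∀ v, (R v).prefers x y) : (f N R).1 y = 0 := by
  classical
  by_contra hne
  set q := f N R with hq
  have hy : 0 < q.1 y := lt_of_le_of_ne (q.2.1 y) (Ne.symm hne)
  obtain ⟨v₀, hv₀⟩ := N.2
  have hxy : x ≠ y := fun e => (R ⟨v₀, hv₀⟩).irrefl y (by simpa [e] using h ⟨v₀, hv₀⟩)
  -- All of the mass of y is moved to x. By linearity in the first lottery, the gain is the moved
  -- mass times the difference of scores.
  let d : A → ℝ := fun z => q.1 y * ((if z = x then 1 else 0) - if z = y then 1 else 0)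
  have hd : ∀ g : A → ℝ, ∑ z, d z * g z = q.1 y * (g x - g y) := fun g => by
    simp only [d, mul_assoc, ← Finset.mul_sum, sub_mul, Finset.sum_sub_distrib, ite_mul, one_mul,
      zero_mul, Finset.sum_ite_eq', Finset.mem_univ, if_true]
  let p : Lottery A := ⟨fun z => q.1 z + d z, by
    constructor
    · intro z
      have hz := q.2.1 z
      have : 0 ≤ q.1 y := hy.le
      by_cases h1 : z = x
      · subst h1; simp only [d, if_true, hxy, if_false]; linarith
      · by_cases h2 : z = y
        · subst h2; simp only [d, if_true, h1, if_false]; linarith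
        · simp only [d, h1, h2, if_false]; linarith
    · have := hd fun _ => 1
      simp only [mul_one, sub_self, mul_zero] at this
      rw [Finset.sum_add_distrib, this, q.2.2, add_zero]⟩
  have hlt : ∀ v, winProb (R v) q p < winProb (R v) p q := fun v => by
    have h1 := winProb_sub (R v) p q
    have h2 := winProb_sub (R v) q q
    have h3 := hd (score (R v) q.1)
    simp only [p, add_mul, Finset.sum_add_distrib, h3] at h1
    have := mul_pos hy (sub_pos.2 (score_lt q.2.1 (h v) hy))
    linarith
  exact hf R ⟨p, fun v => (hlt v).le, ⟨v₀, hv₀⟩, (hlt _).le, not_le.2 (hlt _)⟩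

end Score

/-! ### Rankings of four alternatives as preferences on all of A -/

section Extension

variable {A : Type*}

lemma PrefRel.rename_rename (π σ : Equiv.Perm A) (r : PrefRel A) :
    (r.rename σ).rename π = r.rename (π * σ) := rfl

/-- The preference relation that orders the range of `e` according to `o` and is otherwise given
by `r`. -/
noncomputable def PrefRel.reorder (r : PrefRel A) (e : Fin 4 ↪ A) (o : Ranking) : PrefRel A :=
  r.rename (o.viaEmbedding e)

/-- Lets neutrality on A act on rankings by left multiplication, as in the `neutral` field of
`Rule`. -/
lemma PrefRel.rename_reorder (r : PrefRel A) (e : Fin 4 ↪ A) (π o : Ranking) :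
    (r.reorder e o).rename (π.viaEmbedding e) = r.reorder e (π * o) := by
  rw [reorder, rename_rename, reorder, ← Equiv.Perm.viaEmbeddingHom_apply,
    ← Equiv.Perm.viaEmbeddingHom_apply, ← Equiv.Perm.viaEmbeddingHom_apply, map_mul]

/-- `r` ranks the range of `e` at the top, in the natural order. -/
structure PrefRel.IsTop (r : PrefRel A) (e : Fin 4 ↪ A) : Prop where
  prefers_of_lt : ∀ i j, i < j → r.prefers (e i) (e j)
  prefers_of_notMem : ∀ i x, x ∉ Set.range e → r.prefers (e i) x

namespace PrefRel.IsTop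

variable {r : PrefRel A} {e : Fin 4 ↪ A}

lemma reorder_prefers (hr : r.IsTop e) (o : Ranking) (i j : Fin 4) :
    (r.reorder e o).prefers (e (o i)) (e (o j)) ↔ i < j := by
  rw [← Equiv.Perm.viaEmbedding_apply, ← Equiv.Perm.viaEmbedding_apply]
  simp only [reorder, rename, Equiv.symm_apply_apply]
  refine ⟨fun h => ?_, hr.prefers_of_lt i j⟩
  by_contra hij
  rcases (not_lt.1 hij).lt_or_eq with h' | rfl
  · exact r.irrefl _ (r.trans _ _ _ h (hr.prefers_of_lt _ _ h'))
  · exact r.irrefl _ h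

lemma reorder_prefers_of_notMem (hr : r.IsTop e) (o : Ranking) (i : Fin 4) {x : A} (hx : x ∉ Set.range e) :
    (r.reorder e o).prefers (e i) x := by
  obtain ⟨j, rfl⟩ := o.surjective i
  have h := hr.prefers_of_notMem j x hx
  have hx' := Equiv.Perm.viaEmbedding_apply_of_notMem o e x hx
  rw [← Equiv.Perm.viaEmbedding_apply, ← hx']
  simpa only [reorder, rename, Equiv.symm_apply_apply] using h

lemma reorder_winProb [Fintype A] (hr : r.IsTop e) (o : Ranking) {p q : Lottery A}
    (hp : ∀ x ∉ Set.range e, p.1 x = 0) (hq : ∀ x ∉ Set.range e, q.1 x = 0) :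
    winProb (r.reorder e o) p q =
      ∑ i, ∑ j, if i < j then p.1 (e (o i)) * q.1 (e (o j)) else 0 := by
  classical
  have hinj : Function.Injective fun i => e (o i) := e.injective.comp o.injective
  have hmem : ∀ x, x ∉ Set.range (fun i => e (o i)) → x ∉ Set.range e := by
    rintro x hx ⟨i, rfl⟩
    exact hx ⟨o.symm i, by simp⟩
  symm
  refine Fintype.sum_of_injective _ hinj _ _ (fun x hx => ?_) fun i => ?_
  · simp [hp x (hmem x hx)]
  · refine Fintype.sum_of_injective _ hinj _ _ (fun y hy => ?_) fun j => ?_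
    · simp [hq y (hmem y hy)]
    · simp only [hr.reorder_prefers]

lemma reorder_winProb_sub [Fintype A] (hr : r.IsTop e) (o : Ranking) {p q : Lottery A}
    (hp : ∀ x ∉ Set.range e, p.1 x = 0) (hq : ∀ x ∉ Set.range e, q.1 x = 0) :
    winProb (r.reorder e o) p q - winProb (r.reorder e o) q p =
      phi o (fun i => p.1 (e i)) (fun i => q.1 (e i)) := by
  rw [hr.reorder_winProb o hp hq, hr.reorder_winProb o hq hp]
  simp only [Fin.sum_univ_four, phi, bracket]
  simp [Fin.lt_def]
  ring

end PrefRel.IsTop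

end Extension

/-! ### From a social decision scheme to a rule -/

section Restriction

variable {A : Type*} [Fintype A]

open Classical in
/-- The lottery that a scheme selects if the four top alternatives of `r` are reordered according
to the rankings in `s`. -/
noncomputable def SDS.restrict (f : SDS A) (N : Electorate) (r : PrefRel A) (e : Fin 4 ↪ A)
    (s : Multiset Ranking) : Fin 4 → ℝ :=
  -- The default 0 is met only for multisets whose size differs from the number of voters. By
  -- anonymity the choice of ρ is immaterial.
  if h : ∃ ρ : {v // v ∈ N.1} → Ranking, Finset.univ.val.map ρ = s then
    fun i => (f N fun v => r.reorder e (h.choose v)).1 (e i)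
  else 0

variable {f : SDS A} {N : Electorate} {r : PrefRel A} {e : Fin 4 ↪ A}

lemma SDS.restrict_map (hf : f.AnonymousOn N) (ρ : {v // v ∈ N.1} → Ranking) :
    f.restrict N r e (Finset.univ.val.map ρ) = fun i => (f N fun v => r.reorder e (ρ v)).1 (e i) := by
  have h : ∃ ρ' : {v // v ∈ N.1} → Ranking, Finset.univ.val.map ρ' = Finset.univ.val.map ρ := ⟨ρ, rfl⟩
  rw [restrict, dif_pos h]
  obtain ⟨σ, hσ⟩ := exists_perm_of_map_univ_eq h.choose_spec
  have := hf (fun v => r.reorder e (ρ v)) σ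
  simp only [hσ] at this
  rw [this]

lemma SDS.eq_zero_of_notMem_range (heff : f.PCEfficientOn N) (hr : r.IsTop e)
    (ρ : {v // v ∈ N.1} → Ranking) {x : A} (hx : x ∉ Set.range e) :
    (f N fun v => r.reorder e (ρ v)).1 x = 0 :=
  heff.eq_zero (x := e 0) fun v => hr.reorder_prefers_of_notMem (ρ v) 0 hx

/-- The rule on four alternatives that is induced by a social decision scheme. -/
noncomputable def SDS.toRule (hr : r.IsTop e) (hanon : f.AnonymousOn N) (hneut : f.NeutralOn N)
    (heff : f.PCEfficientOn N) (hsp : f.PCStrategyproofOn N) : Rule N.1.card where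
  F := f.restrict N r e
  nonneg s hs i := by
    obtain ⟨ρ, rfl⟩ := exists_map_univ_eq (V := {v // v ∈ N.1}) (s := s) (by simpa using hs)
    rw [restrict_map hanon]
    exact (f N _).2.1 _
  sum_one s hs := by
    obtain ⟨ρ, rfl⟩ := exists_map_univ_eq (V := {v // v ∈ N.1}) (s := s) (by simpa using hs)
    simp only [restrict_map hanon]
    rw [← (f N fun v => r.reorder e (ρ v)).2.2, ← Fintype.sum_of_injective e e.injective
      (fun i => (f N fun v => r.reorder e (ρ v)).1 (e i)) _
      (fun x hx => eq_zero_of_notMem_range heff hr ρ hx) fun _ => rfl, Fin.sum_univ_four]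
  neutral s hs π i := by
    obtain ⟨ρ, rfl⟩ := exists_map_univ_eq (V := {v // v ∈ N.1}) (s := s) (by simpa using hs)
    rw [Multiset.map_map]
    simp only [restrict_map hanon]
    rw [← hneut _ (π.viaEmbedding e) (e i), Equiv.Perm.viaEmbedding_apply]
    simp only [PrefRel.rename_reorder, Function.comp]
  sp t ht o o' := by
    classical
    obtain ⟨ρ, hρ⟩ := exists_map_univ_eq (V := {v // v ∈ N.1}) (s := {o} + t)
      (by simp; omega)
    obtain ⟨v, -, hv⟩ := Multiset.mem_map.1 (show o ∈ Finset.univ.val.map ρ by rw [hρ]; simp)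
    rw [← hv] at hρ
    rw [← hv, ← hρ, ← map_univ_update hρ o', restrict_map hanon, restrict_map hanon,
      ← hr.reorder_winProb_sub _ (fun x hx => eq_zero_of_notMem_range heff hr ρ hx)
        (fun x hx => eq_zero_of_notMem_range heff hr _ hx)]
    refine sub_nonneg.2 (hsp v (fun w => r.reorder e (ρ w)) _ fun w hw => ?_)
    simp only [Function.update_of_ne hw]
  eff s hs p hp hp1 hall o ho := by
    obtain ⟨ρ, rfl⟩ := exists_map_univ_eq (V := {v // v ∈ N.1}) (s := s) (by simpa using hs)
    rw [restrict_map hanon] at hall ⊢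
    obtain ⟨v, -, rfl⟩ := Multiset.mem_map.1 ho
    have he : ∀ x ∉ Set.range e, Function.extend e p 0 x = 0 := fun x hx =>
      Function.extend_apply' _ _ _ hx
    -- A dominating lottery on the four alternatives, extended by 0, would dominate on A as well.
    let p' : Lottery A := ⟨Function.extend e p 0, by
      constructor
      · intro x
        by_cases hx : x ∈ Set.range e
        · obtain ⟨i, rfl⟩ := hx
          rw [e.injective.extend_apply]
          exact hp i
        · rw [he x hx]
      · rw [← hp1, ← Fintype.sum_of_injective e e.injective p _ he fun i =>
          (e.injective.extend_apply p 0 i).symm, Fin.sum_univ_four]⟩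
    have hphi : ∀ w, winProb (r.reorder e (ρ w)) p' (f N fun v => r.reorder e (ρ v)) -
        winProb (r.reorder e (ρ w)) (f N fun v => r.reorder e (ρ v)) p' =
        phi (ρ w) p fun i => (f N fun v => r.reorder e (ρ v)).1 (e i) := fun w => by
      rw [hr.reorder_winProb_sub _ he fun x hx => eq_zero_of_notMem_range heff hr ρ hx]
      simp only [p', e.injective.extend_apply]
    by_contra hlt
    have hw : ∀ w, PCPrefers (r.reorder e (ρ w)) p' (f N fun v => r.reorder e (ρ v)) := fun w => by
      have := hall (ρ w) (Multiset.mem_map_of_mem _ (Finset.mem_univ w))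
      rw [← hphi] at this
      exact sub_nonneg.1 this
    refine heff _ ⟨p', hw, v, hw v, fun h => hlt ?_⟩
    rw [← hphi]
    exact sub_nonpos.2 h
  pareto s hs x y h := by
    obtain ⟨ρ, rfl⟩ := exists_map_univ_eq (V := {v // v ∈ N.1}) (s := s) (by simpa using hs)
    rw [restrict_map hanon]
    refine heff.eq_zero (x := e x) fun v => ?_
    obtain ⟨i, j, hij, rfl, rfl⟩ := h (ρ v) (Multiset.mem_map_of_mem _ (Finset.mem_univ v))
    exact (hr.reorder_prefers _ _ _).2 hij

end Restriction

lemma PrefRel.exists_isTop {A : Type*} [Fintype A] (hm : 4 ≤ Fintype.card A) :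
    ∃ (r : PrefRel A) (e : Fin 4 ↪ A), r.IsTop e := by
  let b := Fintype.equivFin A
  let e : Fin 4 ↪ A := (Fin.castLEEmb hm).trans b.symm.toEmbedding
  have he : ∀ i, b (e i) = Fin.castLE hm i := fun i => b.apply_symm_apply _
  let r : PrefRel A :=
    { prefers := fun x y => b x < b y
      irrefl := fun x => lt_irrefl _
      trans := fun _ _ _ => lt_trans
      total := fun x y h => lt_or_gt_of_ne (b.injective.ne h) }
  refine ⟨r, e, fun i j h => ?_, fun i x hx => ?_⟩
  · change b (e i) < b (e j)
    rw [he, he]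
    exact h
  · change b (e i) < b x
    rw [he]
    by_contra hlt
    have hx4 : (b x).val < 4 := lt_of_le_of_lt (Fin.le_def.1 (not_lt.1 hlt)) i.isLt
    exact hx ⟨⟨b x, hx4⟩, b.injective (he _)⟩

theorem theorem2 {A : Type*} [Fintype A] (hm : 4 ≤ Fintype.card A)
    (N : Electorate) (hN : 3 ≤ N.1.card) (hN4 : N.1.card ≠ 4) (hN6 : N.1.card ≠ 6)
    (f : SDS A) (hanon : f.AnonymousOn N) (hneut : f.NeutralOn N) (heff : f.PCEfficientOn N) :
    f.PCManipulableOn N := by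
  intro hsp
  obtain ⟨r, e, hr⟩ := PrefRel.exists_isTop hm
  exact not_rule hN hN4 (SDS.toRule hr hanon hneut heff hsp)
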